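/- Let $K$ be a field and $\mathcal D$ a finite-dimensional commutative $K$-algebra; write $\mathcal D=\mathcal D_1\times\cdots\times\mathcal D_t$ with each $\mathcal D_i$ local, and assume that the residue field of every $\mathcal D_i$ is $K$. A $\mathcal D$-ring $(R,e)$ is a commutative $K$-algebra $R$ with a $K$-algebra homomorphism $e\colon R\to R\otimes_K\mathcal D$. It is a $\mathcal D^*$-ring if $(\mathrm{id}_R\otimes\beta)\circ(e\otimes\mathrm{id}_{\mathcal D})\circ e=(e\otimes\mathrm{id}_{\mathcal D})\circ e$, where $\beta(x\otimes y)=y\otimes x$ on $\mathcal D\otimes_K\mathcal D$; equivalently, the coordinate maps of $e$ with respect to a $K$-basis of $\mathcal D$ commute pairwise. The associated endomorphism $\sigma_i$ of $(R,e)$, $1\le i\le t$, is the composite $R\xrightarrow{\,e\,}R\otimes_K\mathcal D\to R\otimes_K K=R$ of $e$ with the map induced by the residue map $\mathcal D\to\mathcal D_i\to K$. An ideal $I$ of $R$ is a $\mathcal D$-ideal if $e(I)\subseteq I\otimes_K\mathcal D$. A $\mathcal D$-ideal $I$ is perfect if it is a radical ideal and is reflexive, i.e. $a\,\sigma_i(a)\in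 I$ implies $a\in I$ for all $a\in R$ and $1\le i\le t$. A $\mathcal D^*$-algebra over $(R,e)$ is a $\mathcal D^*$-ring $(S,f)$ with $S$ an $R$-algebra whose structure map $\iota\colon R\to S$ is a $K$-algebra homomorphism satisfying $(\iota\otimes\mathrm{id}_{\mathcal D})\circ e=f\circ\iota$. It is finitely $\mathcal D$-generated if there is a finite subset of $S$ such that $S$ is the only $R$-subalgebra $A$ of $S$ that contains this subset and satisfies $f(A)\subseteq A\otimes_K\mathcal D$. Let $(R,e)$ be a $\mathcal D^*$-ring such that $R$ is a $\mathbb Q$-algebra and all its associated endomorphisms $\sigma_1,\dots,\sigma_t$ are injective, and let $(S,f)$ be a finitely $\mathcal D$-generated $\mathcal D^*$-algebra over $(R,e)$. If $R$ has the ascending chain condition on perfect $\mathcal D$-ideals, then $S$ has the ascending chain condition on perfect $\mathcal D$-ideals. -/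

import Mathlib

open scoped TensorProduct

noncomputable section

namespace GenOp

variable {K D R S : Type*} [Field K] [CommRing D] [Algebra K D]
  [CommRing R] [Algebra K R] [CommRing S] [Algebra K S]

/- A `𝒟`-ring is a commutative `K`-algebra `R` with a `K`-algebra homomorphism
`e : R →ₐ[K] R ⊗[K] D`; we simply carry `e` as an argument. -/

/-- The residue field of every local factor of `D` is `K`. For a finite-dimensional `K`-algebra
`D = D₁ × ⋯ × Dₜ` with `Dᵢ` local, the maximal ideals of `D` correspond to the factors `Dᵢ`, and
the quotient of `D` by the `i`-th maximal ideal is the residue field of `Dᵢ`. -/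
def HasBaseResidueFields (K D : Type*) [Field K] [CommRing D] [Algebra K D] : Prop :=
  ∀ m : MaximalSpectrum D, Function.Bijective (algebraMap K (D ⧸ m.asIdeal))

/-- The residue map `D → Dᵢ → K` of the local factor belonging to the maximal ideal `m`. -/
def residueMap (hD : HasBaseResidueFields K D) (m : MaximalSpectrum D) : D →ₐ[K] K :=
  ((AlgEquiv.ofBijective (Algebra.ofId K (D ⧸ m.asIdeal)) (hD m)).symm :
    (D ⧸ m.asIdeal) →ₐ[K] K).comp (Ideal.Quotient.mkₐ K m.asIdeal)

/-- The associated endomorphism `σᵢ` of `(R, e)`: the composite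
`R → R ⊗ D → R ⊗ K = R` of `e` with the residue map of the `i`-th local factor of `D`. -/
def assocEnd (hD : HasBaseResidueFields K D) (e : R →ₐ[K] R ⊗[K] D) (m : MaximalSpectrum D) :
    R →ₐ[K] R :=
  ((Algebra.TensorProduct.rid K K R : R ⊗[K] K ≃ₐ[K] R) : R ⊗[K] K →ₐ[K] R).comp
    ((Algebra.TensorProduct.map (AlgHom.id K R) (residueMap hD m)).comp e)

/-- `(R, e)` is a `𝒟*`-ring: `(id_R ⊗ β) ∘ 𝒟(e) ∘ e = 𝒟(e) ∘ e`, where `𝒟(e) = e ⊗ id_D` and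
`β (x ⊗ y) = y ⊗ x` on `D ⊗ D` (so that `id_R ⊗ β` maps `(r ⊗ x) ⊗ y` to `(r ⊗ y) ⊗ x`). -/
def IsDStar (e : R →ₐ[K] R ⊗[K] D) : Prop :=
  ∀ r : R,
    TensorProduct.rightComm K R D D
        (Algebra.TensorProduct.map e (AlgHom.id K D) (e r)) =
      Algebra.TensorProduct.map e (AlgHom.id K D) (e r)

/-- `I` is a `𝒟`-ideal: `e(I) ⊆ I ⊗ D`, the latter being the ideal of `R ⊗ D` generated by the
elements `a ⊗ 1` with `a ∈ I`. -/
def IsDIdeal (e : R →ₐ[K] R ⊗[K] D) (I : Ideal R) : Prop :=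
  ∀ a ∈ I, e a ∈ I.map (Algebra.TensorProduct.includeLeft : R →ₐ[K] R ⊗[K] D)

/-- `I` is reflexive: `a σᵢ(a) ∈ I` implies `a ∈ I`, for every associated endomorphism `σᵢ`. -/
def IsReflexive (hD : HasBaseResidueFields K D) (e : R →ₐ[K] R ⊗[K] D) (I : Ideal R) : Prop :=
  ∀ (m : MaximalSpectrum D) (a : R), a * assocEnd hD e m a ∈ I → a ∈ I

/-- A perfect `𝒟`-ideal is a reflexive `𝒟`-ideal that is also a radical ideal. -/
structure IsPerfect (hD : HasBaseResidueFields K D) (e : R →ₐ[K] R ⊗[K] D) (I : Ideal R) :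
    Prop where
  isDIdeal : IsDIdeal e I
  isReflexive : IsReflexive hD e I
  isRadical : I.IsRadical

/-- The ascending chain condition on perfect `𝒟`-ideals. -/
def ACCPerfect (hD : HasBaseResidueFields K D) (e : R →ₐ[K] R ⊗[K] D) : Prop :=
  ∀ I : ℕ →o {I : Ideal R // IsPerfect hD e I}, ∃ n, ∀ k, n ≤ k → I n = I k

section Algebra

variable [Algebra R S] [IsScalarTower K R S]

/-- `(S, f)` is an `(R, e)`-algebra: the structure map `R → S` is a `𝒟`-homomorphism. -/
def IsDAlgebra (e : R →ₐ[K] R ⊗[K] D) (f : S →ₐ[K] S ⊗[K] D) : Prop :=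
  ∀ r : R,
    Algebra.TensorProduct.map (IsScalarTower.toAlgHom K R S) (AlgHom.id K D) (e r) =
      f (algebraMap R S r)

variable (R) in
/-- `(S, f)` is finitely `𝒟`-generated over `R`: for some finite set `s`, the only `R`-subalgebra
`A` of `S` that contains `s` and is closed under the operators, `f(A) ⊆ A ⊗ D`, is `S`. -/
def FinitelyDGenerated (f : S →ₐ[K] S ⊗[K] D) : Prop :=
  ∃ s : Finset S, ∀ A : Subalgebra R S, (s : Set S) ⊆ A →
    (∀ a ∈ A, f a ∈
      (Algebra.TensorProduct.map (A.val.restrictScalars K) (AlgHom.id K D)).range) →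
    A = ⊤

end Algebra

end GenOp

end

/-! This is a Ritt–Raudenbush basis theorem. A chain of ideals of D with one-dimensional quotients
gives a basis for which each coordinate operator is an associated endomorphism or a twisted
derivation up to products of earlier operators (`exists_basis_isTriangularAt`). Since S is a
quotient of a 𝒟-polynomial ring over R (`exists_surjective_isDHom`) and perfect ideals pull back
injectively, it suffices to treat that ring (`ACCPerfect.polyD`).

The chain condition means that every perfect ideal is the perfect closure of a finite set. Otherwise
there is a maximal counterexample P, which is prime because colons of perfect ideals by elements are
perfect (`IsPerfect.colon`). By Dickson's lemma, finitely many elements of P with initial and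
separant outside P have shifts that can reduce every such element. Let h be the product of their
initials and separants, so h ∉ P. An operator either transports initial and separant by an
endomorphism, or makes the polynomial linear in its new leader, with the transported separant as
initial (`IsReducer.op`). By reflexivity, a perfect ideal containing a transported initial contains
h. Reduction therefore gives hP ⊆ J for a finitely generated perfect J ⊆ P (`mul_mem_of_reducers`);
the chain condition in R supplies the constants of P.

By maximality P lies in the perfect closure of h and a finite subset of P, which may be put into J.
For F ∈ P the perfect ideal J : F contains h and this subset, hence F. So F² ∈ J and P = J, a
contradiction. -/

namespace GenOp

/-! ### A triangular basis of the dual of D. -/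

section Triangular

variable {K D : Type*} [Field K] [CommRing D] [Algebra K D]

theorem sub_residueMap_mem (hD : HasBaseResidueFields K D) (m : MaximalSpectrum D) (x : D) :
    x - algebraMap K D (residueMap hD m x) ∈ m.asIdeal := by
  rw [← Ideal.Quotient.eq_zero_iff_mem, map_sub, sub_eq_zero]
  exact ((AlgEquiv.ofBijective (Algebra.ofId K (D ⧸ m.asIdeal)) (hD m)).apply_symm_apply
    (Ideal.Quotient.mk m.asIdeal x)).symm

/-- The `k`-th functional of the family `l` is either a residue map, or it satisfies a twisted
Leibniz rule modulo products of functionals of smaller index. -/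
def IsTriangularAt {ι : Type*} [Preorder ι] [LocallyFiniteOrderBot ι]
    (hD : HasBaseResidueFields K D) (l : ι → D →ₗ[K] K) (k : ι) : Prop :=
  ∃ m : MaximalSpectrum D, (∀ x, l k x = residueMap hD m x) ∨
    ((∃ s : ι → K, ∀ x, residueMap hD m x = ∑ j ∈ Finset.Iio k, s j * l j x) ∧
      ∃ c : ι → ι → K, ∀ x y, l k (x * y) =
        l k x * residueMap hD m y + residueMap hD m x * l k y +
          ∑ i ∈ Finset.Iio k, ∑ j ∈ Finset.Iio k, c i j * (l i x * l j y))

theorem IsTriangularAt.congr {hD : HasBaseResidueFields K D} {l l' : ℕ → D →ₗ[K] K} {k : ℕ}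
    (h : IsTriangularAt hD l k) (hl : ∀ j ≤ k, l' j = l j) : IsTriangularAt hD l' k := by
  have hj : ∀ j ∈ Finset.Iio k, l' j = l j := fun j hj => hl j (Finset.mem_Iio.1 hj).le
  obtain ⟨m, h | ⟨⟨s, hs⟩, c, hc⟩⟩ := h
  · exact ⟨m, .inl fun x => by rw [hl k le_rfl, h]⟩
  · refine ⟨m, .inr ⟨⟨s, fun x => ?_⟩, c, fun x y => ?_⟩⟩
    · rw [hs]
      exact Finset.sum_congr rfl fun j h => by rw [hj j h]
    · rw [hl k le_rfl, hc]
      congr 1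
      exact Finset.sum_congr rfl fun i hi => Finset.sum_congr rfl fun j h => by
        rw [hj j h, hj i hi]

/-- Take I' maximal among the ideals strictly below I. Then I/I' is simple, so it is D/m, on which D
acts through the residue map and which is a line over K. -/
theorem exists_covBy_residueMap [FiniteDimensional K D] (hD : HasBaseResidueFields K D)
    {I : Ideal D} (hI : I ≠ ⊥) : ∃ I' : Ideal D, I' < I ∧ ∃ m : MaximalSpectrum D,
      (∀ x, ∀ w ∈ I, x * w - algebraMap K D (residueMap hD m x) * w ∈ I') ∧
      ∀ v ∈ I, v ∉ I' → ∀ w ∈ I, ∃ c : K, w - algebraMap K D c * v ∈ I' := by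
  have : IsNoetherianRing D := IsNoetherianRing.of_finite K D
  obtain ⟨I', hI'⟩ := exists_covBy_of_wellFoundedGT (a := I) (by simpa using hI)
  have hs := (covBy_iff_quot_is_simple hI'.le).1 hI'
  obtain ⟨m, hm, ⟨φ⟩⟩ := isSimpleModule_iff_quot_maximal.1 hs
  have key : ∀ x, ∀ w ∈ I,
      x * w - algebraMap K D (residueMap hD ⟨m, hm⟩ x) * w ∈ I' := by
    intro x w hw
    have h0 : x - algebraMap K D (residueMap hD ⟨m, hm⟩ x) ∈ m := sub_residueMap_mem hD ⟨m, hm⟩ x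
    set y := x - algebraMap K D (residueMap hD ⟨m, hm⟩ x)
    have h1 : y • (Submodule.Quotient.mk (p := Submodule.comap I.subtype I') ⟨w, hw⟩) = 0 := by
      apply φ.injective
      rw [map_smul, map_zero]
      obtain ⟨z, hz⟩ := Ideal.Quotient.mk_surjective (φ (Submodule.Quotient.mk ⟨w, hw⟩))
      rw [← hz]
      change Ideal.Quotient.mk m (y * z) = 0
      exact Ideal.Quotient.eq_zero_iff_mem.2 (m.mul_mem_right z h0)
    rw [← Submodule.Quotient.mk_smul, Submodule.Quotient.mk_eq_zero] at h1
    have h2 : y * w ∈ I' := h1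
    rwa [sub_mul] at h2
  refine ⟨I', hI'.lt, ⟨m, hm⟩, key, fun v hv hv' w hw => ?_⟩
  have hsup : I' ⊔ Ideal.span {v} = I := by
    refine (hI'.eq_or_eq le_sup_left
      (sup_le hI'.le ((Ideal.span_singleton_le_iff_mem _).2 hv))).resolve_left fun h => hv' ?_
    rw [← h]
    exact (le_sup_right : _ ≤ I' ⊔ Ideal.span {v}) (Ideal.mem_span_singleton_self v)
  rw [← hsup] at hw
  obtain ⟨a, ha, b, hb, rfl⟩ := Submodule.mem_sup.1 hw
  obtain ⟨x, rfl⟩ := Ideal.mem_span_singleton'.1 hb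
  refine ⟨residueMap hD ⟨m, hm⟩ x, ?_⟩
  rw [add_sub_assoc]
  exact I'.add_mem ha (key x v hv)

/-- `I` is the common kernel of `n` independent functionals forming a triangular family. -/
def IsTriangularKernel (hD : HasBaseResidueFields K D) (n : ℕ) (l : ℕ → D →ₗ[K] K)
    (I : Ideal D) : Prop :=
  (∀ x, x ∈ I ↔ ∀ k < n, l k x = 0) ∧ (∀ k < n, IsTriangularAt hD l k) ∧
    ∀ c : ℕ → K, ∃ x, ∀ k < n, l k x = c k

theorem IsTriangularKernel.succ {hD : HasBaseResidueFields K D} {n : ℕ} {l : ℕ → D →ₗ[K] K}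
    {I I' : Ideal D} (h : IsTriangularKernel hD n l I) {m : D →ₗ[K] K}
    (hI : ∀ x, x ∈ I' ↔ x ∈ I ∧ m x = 0) {v : D} (hv : v ∈ I) (hmv : m v = 1)
    (htri : IsTriangularAt hD (Function.update l n m) n) :
    IsTriangularKernel hD (n + 1) (Function.update l n m) I' := by
  obtain ⟨h1, h2, h3⟩ := h
  have hlt : ∀ k < n, Function.update l n m k = l k := fun k hk =>
    Function.update_of_ne hk.ne _ _
  have hn : Function.update l n m n = m := Function.update_self ..
  refine ⟨fun x => ?_, fun k hk => ?_, fun c => ?_⟩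
  · rw [Nat.forall_lt_succ_right, hn, hI, h1]
    exact and_congr_left fun _ => forall₂_congr fun k hk => by rw [hlt k hk]
  · rcases (Nat.lt_succ_iff_lt_or_eq.1 hk) with hk | rfl
    · exact (h2 k hk).congr fun j hj => hlt j (hj.trans_lt hk)
    · exact htri
  · obtain ⟨x, hx⟩ := h3 c
    refine ⟨x + (c n - m x) • v, fun k hk => ?_⟩
    rcases (Nat.lt_succ_iff_lt_or_eq.1 hk) with hk | rfl
    · rw [hlt k hk, map_add, map_smul, (h1 v).1 hv k hk, hx k hk, smul_zero, add_zero]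
    · rw [hn, map_add, map_smul, hmv]
      simp

theorem IsTriangularKernel.exists_lt [FiniteDimensional K D] {hD : HasBaseResidueFields K D}
    {n : ℕ} {l : ℕ → D →ₗ[K] K} {I : Ideal D} (h : IsTriangularKernel hD n l I) (hI : I ≠ ⊥) :
    ∃ I' < I, ∃ l', IsTriangularKernel hD (n + 1) l' I' := by
  obtain ⟨I', hlt, m, hm, hc⟩ := exists_covBy_residueMap hD hI
  refine ⟨I', hlt, ?_⟩
  set ρ := residueMap hD m
  obtain ⟨v, hv, hv'⟩ := SetLike.exists_of_lt hlt
  have hsurj := h.2.2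
  -- a functional vanishing on `I'` but not at `w ∈ I` cuts out `I'` in `I`
  have hker : ∀ (μ : D →ₗ[K] K) (w : D), w ∈ I → w ∉ I' → μ w = 1 → (∀ x ∈ I', μ x = 0) →
      ∀ x, x ∈ I' ↔ x ∈ I ∧ μ x = 0 := by
    intro μ w hw hw' hμw hμ x
    refine ⟨fun hx => ⟨hlt.le hx, hμ x hx⟩, fun ⟨hx, hx0⟩ => ?_⟩
    obtain ⟨c, hcx⟩ := hc w hw hw' x hx
    have := hμ _ hcx
    rw [map_sub, hx0, ← Algebra.smul_def, map_smul, hμw] at this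
    have hc0 : c = 0 := by simpa using this
    simpa [hc0] using hcx
  -- Either ρ is already a combination of the earlier functionals, and any functional cutting out I'
  -- works, or ρ itself cuts out I' in I.
  by_cases hρ : ∀ x ∈ I, ρ x = 0
  · obtain ⟨f, hfv, hf⟩ : ∃ f : D →ₗ[K] K, f v ≠ 0 ∧ I'.restrictScalars K ≤ LinearMap.ker f :=
      Submodule.exists_le_ker_of_notMem (p := I'.restrictScalars K) hv'
    let μ : D →ₗ[K] K := (f v)⁻¹ • f
    have hμv : μ v = 1 := inv_mul_cancel₀ hfv
    have hμ : ∀ x ∈ I', μ x = 0 := fun x hx => by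
      simp [μ, LinearMap.mem_ker.1 (hf hx)]
    refine ⟨Function.update l n μ, h.succ (hker μ v hv hv' hμv hμ) hv hμv ⟨m, .inr ?_⟩⟩
    -- The `w i` are dual to the earlier functionals, so subtracting the corresponding combination
    -- moves any x into I.
    choose w hw using fun i : ℕ => hsurj (Pi.single i 1)
    have hdec : ∀ x, x - ∑ i ∈ Finset.Iio n, l i x • w i ∈ I := by
      refine fun x => (h.1 _).2 fun k hk => ?_
      rw [map_sub, map_sum, Finset.sum_eq_single k]
      · rw [map_smul, hw k k hk]; simp
      · intro j hj hjk
        rw [map_smul, hw j k hk, Pi.single_eq_of_ne hjk.symm, smul_zero]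
      · intro hk'; exact absurd (Finset.mem_Iio.2 hk) hk'
    have hup : ∀ j ∈ Finset.Iio n, Function.update l n μ j = l j := fun j hj =>
      Function.update_of_ne (Finset.mem_Iio.1 hj).ne _ _
    refine ⟨⟨fun i => ρ (w i), fun x => ?_⟩, ?_⟩
    · have := hρ _ (hdec x)
      rw [map_sub, sub_eq_zero, map_sum] at this
      rw [this]
      refine Finset.sum_congr rfl fun j hj => ?_
      rw [hup j hj, map_smul, smul_eq_mul, mul_comm]
    -- `β` measures the failure of `μ` to be a ρ-derivation. It is symmetric and vanishes on I in
    -- each argument, so it is a bilinear expression in the earlier functionals.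
    · let β : D →ₗ[K] D →ₗ[K] K := (LinearMap.mul K D).compr₂ μ -
        (LinearMap.mul K K).compl₁₂ μ ρ.toLinearMap - (LinearMap.mul K K).compl₁₂ ρ.toLinearMap μ
      have hβ : ∀ x y, β x y = μ (x * y) - μ x * ρ y - ρ x * μ y := fun x y => rfl
      have hβl : ∀ x ∈ I, ∀ y, β x y = 0 := by
        intro x hx y
        have := hμ _ (hm y x hx)
        rw [map_sub, ← Algebra.smul_def, map_smul, smul_eq_mul, mul_comm y x] at this
        rw [hβ, hρ x hx]
        linear_combination this
      have hβs : ∀ x y, β x y = β y x := fun x y => by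
        rw [hβ, hβ, mul_comm x y]; ring
      refine ⟨fun i j => β (w i) (w j), fun x y => ?_⟩
      have e1 : β x y = β (∑ i ∈ Finset.Iio n, l i x • w i) y := by
        have := hβl _ (hdec x) y
        rwa [map_sub, LinearMap.sub_apply, sub_eq_zero] at this
      have e2 : ∀ z, β z y = β z (∑ i ∈ Finset.Iio n, l i y • w i) := fun z => by
        have := hβl _ (hdec y) z
        rw [hβs, map_sub, sub_eq_zero] at this
        exact this
      have e3 : β x y = ∑ i ∈ Finset.Iio n, ∑ j ∈ Finset.Iio n,
          β (w i) (w j) * (l i x * l j y) := by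
        rw [e1, map_sum β, LinearMap.sum_apply]
        refine Finset.sum_congr rfl fun i hi => ?_
        rw [e2, map_sum]
        refine Finset.sum_congr rfl fun j hj => ?_
        simp only [map_smul, LinearMap.smul_apply, smul_eq_mul]
        ring
      rw [Function.update_self]
      have e4 : ∑ i ∈ Finset.Iio n, ∑ j ∈ Finset.Iio n, β (w i) (w j) *
          (Function.update l n μ i x * Function.update l n μ j y) = β x y := by
        rw [e3]
        exact Finset.sum_congr rfl fun i hi => Finset.sum_congr rfl fun j hj => by
          rw [hup i hi, hup j hj]
      rw [e4, hβ]
      ring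
  · push Not at hρ
    obtain ⟨w, hw, hρw⟩ := hρ
    -- An x ∈ I' with ρ(x) ≠ 0 would act on I/I' both as zero and as an invertible scalar.
    have hρ0 : ∀ x ∈ I', ρ x = 0 := by
      intro x hx
      by_contra hx0
      have hmem : ∀ w ∈ I, w ∈ I' := fun w hw => by
        have h1 := I'.sub_mem (I'.mul_mem_right w hx) (hm x w hw)
        rw [sub_sub_cancel] at h1
        have h2 := I'.mul_mem_left (algebraMap K D (ρ x)⁻¹) h1
        rwa [← mul_assoc, ← map_mul, inv_mul_cancel₀ hx0, map_one, one_mul] at h2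
      exact hv' (hmem v hv)
    have hw1 : ρ ((ρ w)⁻¹ • w) = 1 := by
      rw [map_smul, smul_eq_mul, inv_mul_cancel₀ hρw]
    have hwI : (ρ w)⁻¹ • w ∈ I := by
      rw [Algebra.smul_def]; exact I.mul_mem_left _ hw
    have hwI' : (ρ w)⁻¹ • w ∉ I' := fun h => by
      rw [hρ0 _ h] at hw1; exact zero_ne_one hw1
    refine ⟨Function.update l n ρ.toLinearMap,
      h.succ (hker ρ.toLinearMap _ hwI hwI' hw1 hρ0) hwI hw1 ⟨m, .inl fun x => ?_⟩⟩
    rw [Function.update_self]; rfl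

/-- A finite-dimensional algebra all of whose residue fields are the base field has a basis whose
coordinate functionals form a triangular family. -/
theorem exists_basis_isTriangularAt [FiniteDimensional K D] (hD : HasBaseResidueFields K D) :
    ∃ (n : ℕ) (b : Module.Basis (Fin n) K D), ∀ k, IsTriangularAt hD b.coord k := by
  have hnoeth : IsArtinianRing D := isArtinian_of_tower K inferInstance
  have key : ∀ I : Ideal D, (∃ n l, IsTriangularKernel hD n l I) →
      ∃ n l, IsTriangularKernel hD n l ⊥ := by
    intro I
    induction I using WellFoundedLT.induction with
    | ind I ih =>
      rintro ⟨n, l, h⟩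
      by_cases hI : I = ⊥
      · exact ⟨n, l, hI ▸ h⟩
      · obtain ⟨I', hlt, l', h'⟩ := h.exists_lt hI
        exact ih I' hlt ⟨_, l', h'⟩
  obtain ⟨n, l, h1, h2, h3⟩ := key ⊤ ⟨0, 0, by simp, by simp, by simp⟩
  let φ : D →ₗ[K] Fin n → K := LinearMap.pi fun k => l k
  have hφ : Function.Bijective φ := by
    constructor
    · refine (injective_iff_map_eq_zero φ).2 fun x hx => (h1 x).2 fun k hk => ?_
      exact congrFun hx ⟨k, hk⟩
    · intro c
      obtain ⟨x, hx⟩ := h3 fun k => if hk : k < n then c ⟨k, hk⟩ else 0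
      refine ⟨x, funext fun k => ?_⟩
      exact (hx k k.2).trans (by simp)
  let b := Module.Basis.ofEquivFun (LinearEquiv.ofBijective φ hφ)
  have hb : ∀ k x, b.coord k x = l k x := fun k x => by
    simp [b, φ]
  refine ⟨n, b, fun k => ?_⟩
  have hsum : ∀ f : ℕ → K, ∑ j ∈ Finset.Iio (k : ℕ), f j = ∑ j ∈ Finset.Iio k, f j := fun f => by
    rw [← Fin.map_valEmbedding_Iio, Finset.sum_map]; rfl
  obtain ⟨m, h | ⟨⟨s, hs⟩, c, hc⟩⟩ := h2 k k.2
  · exact ⟨m, .inl fun x => (hb k x).trans (h x)⟩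
  · refine ⟨m, .inr ⟨⟨fun j => s j, fun x => ?_⟩, fun i j => c i j, fun x y => ?_⟩⟩
    · rw [hs, hsum]
      simp only [hb]
    · simp only [hb]
      rw [hc, hsum]
      congr 1
      exact Finset.sum_congr rfl fun i _ => hsum _

end Triangular

end GenOp

/-! ### Operators attached to functionals on D. -/

noncomputable section

namespace GenOp

section Operators

variable {K D A B : Type*} [Field K] [CommRing D] [Algebra K D] [CommRing A] [Algebra K A]
  [CommRing B] [Algebra K B]

/-- The map `A ⊗ D → A` induced by a functional on `D`. -/
def contract (A : Type*) [CommRing A] [Algebra K A] (l : D →ₗ[K] K) : A ⊗[K] D →ₗ[K] A :=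
  (TensorProduct.rid K A).toLinearMap ∘ₗ l.lTensor A

@[simp]
theorem contract_tmul (l : D →ₗ[K] K) (a : A) (x : D) : contract A l (a ⊗ₜ x) = l x • a := by
  simp [contract]

/-- The operator on a `D`-ring associated with a functional on `D`. -/
def op (e : A →ₐ[K] A ⊗[K] D) (l : D →ₗ[K] K) : A →ₗ[K] A :=
  contract A l ∘ₗ e.toLinearMap

theorem op_apply (e : A →ₐ[K] A ⊗[K] D) (l : D →ₗ[K] K) (a : A) :
    op e l a = contract A l (e a) := rfl

theorem assocEnd_eq_op (hD : HasBaseResidueFields K D) (e : A →ₐ[K] A ⊗[K] D)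
    (m : MaximalSpectrum D) (a : A) :
    assocEnd hD e m a = op e (residueMap hD m).toLinearMap a := by
  rw [op_apply]
  change Algebra.TensorProduct.rid K K A
    (Algebra.TensorProduct.map (AlgHom.id K A) (residueMap hD m) (e a)) = _
  induction e a using TensorProduct.induction_on with
  | zero => simp
  | tmul a x => simp
  | add x y hx hy => simp only [map_add, hx, hy]

theorem sum_contract_coord {n : ℕ} (b : Module.Basis (Fin n) K D) (t : A ⊗[K] D) :
    ∑ k, contract A (b.coord k) t ⊗ₜ[K] b k = t := by
  induction t using TensorProduct.induction_on with
  | zero => simp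
  | tmul a x =>
    simp only [contract_tmul, TensorProduct.smul_tmul]
    rw [← TensorProduct.tmul_sum]
    congr 1
    exact b.sum_repr x
  | add x y hx hy => simp only [map_add, TensorProduct.add_tmul, Finset.sum_add_distrib, hx, hy]

theorem sum_op_coord {n : ℕ} (b : Module.Basis (Fin n) K D) (e : A →ₐ[K] A ⊗[K] D) (a : A) :
    ∑ k, op e (b.coord k) a ⊗ₜ[K] b k = e a :=
  sum_contract_coord b (e a)

theorem contract_map (φ : A →ₐ[K] B) (l : D →ₗ[K] K) (t : A ⊗[K] D) :
    contract B l (Algebra.TensorProduct.map φ (AlgHom.id K D) t) = φ (contract A l t) := by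
  induction t using TensorProduct.induction_on with
  | zero => simp
  | tmul a x => simp
  | add x y hx hy => simp only [map_add, hx, hy]

/-- A homomorphism of `D`-rings. -/
def IsDHom (e : A →ₐ[K] A ⊗[K] D) (f : B →ₐ[K] B ⊗[K] D) (φ : A →ₐ[K] B) : Prop :=
  ∀ a, Algebra.TensorProduct.map φ (AlgHom.id K D) (e a) = f (φ a)

theorem IsDHom.op_apply {e : A →ₐ[K] A ⊗[K] D} {f : B →ₐ[K] B ⊗[K] D} {φ : A →ₐ[K] B}
    (h : IsDHom e f φ) (l : D →ₗ[K] K) (a : A) : op f l (φ a) = φ (op e l a) := by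
  rw [GenOp.op_apply, GenOp.op_apply, ← h, contract_map]

theorem op_one (e : A →ₐ[K] A ⊗[K] D) (l : D →ₗ[K] K) : op e l 1 = algebraMap K A (l 1) := by
  rw [op_apply, map_one, Algebra.TensorProduct.one_def, contract_tmul, Algebra.algebraMap_eq_smul_one]

theorem op_algHom_mul (e : A →ₐ[K] A ⊗[K] D) (ρ : D →ₐ[K] K) (x y : A) :
    op e ρ.toLinearMap (x * y) = op e ρ.toLinearMap x * op e ρ.toLinearMap y := by
  rw [op_apply, op_apply, op_apply, map_mul]
  generalize e x = s
  generalize e y = t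
  induction s using TensorProduct.induction_on with
  | zero => simp
  | add s s' h h' => simp only [map_add, add_mul, h, h']
  | tmul a p =>
    induction t using TensorProduct.induction_on with
    | zero => simp
    | add s s' h h' => simp only [map_add, mul_add, h, h']
    | tmul b q => simp [Algebra.TensorProduct.tmul_mul_tmul, smul_smul, mul_comm]

/-- Multiplication in A ⊗ D is componentwise on pure tensors, so a product rule for functionals
passes to the operators. -/
theorem op_mul {ι : Type*} (e : A →ₐ[K] A ⊗[K] D) {l r : D →ₗ[K] K} {s : Finset ι}
    {μ : ι → D →ₗ[K] K} {c : ι → ι → K}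
    (h : ∀ x y, l (x * y) = l x * r y + r x * l y +
      ∑ i ∈ s, ∑ j ∈ s, c i j * (μ i x * μ j y)) (x y : A) :
    op e l (x * y) = op e l x * op e r y + op e r x * op e l y +
      ∑ i ∈ s, ∑ j ∈ s, c i j • (op e (μ i) x * op e (μ j) y) := by
  simp only [op_apply, map_mul]
  generalize e x = t
  generalize e y = u
  induction t using TensorProduct.induction_on with
  | zero => simp
  | add t t' h h' =>
    simp only [map_add, add_mul, h, h', smul_add, Finset.sum_add_distrib]
    ring
  | tmul a p =>
    induction u using TensorProduct.induction_on with
    | zero => simp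
    | add s s' h h' =>
      simp only [map_add, mul_add, h, h', smul_add, Finset.sum_add_distrib]
      ring
    | tmul b q =>
      simp only [Algebra.TensorProduct.tmul_mul_tmul, contract_tmul, h, smul_mul_smul_comm,
        smul_smul, ← Finset.sum_smul, ← add_smul]

theorem op_eq_sum {ι : Type*} (e : A →ₐ[K] A ⊗[K] D) {r : D →ₗ[K] K} {s : Finset ι}
    {μ : ι → D →ₗ[K] K} {c : ι → K} (h : ∀ x, r x = ∑ j ∈ s, c j * μ j x) (x : A) :
    op e r x = ∑ j ∈ s, c j • op e (μ j) x := by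
  have : r = ∑ j ∈ s, c j • μ j := by ext x; simp [h]
  subst this
  simp only [op_apply]
  induction e x using TensorProduct.induction_on with
  | zero => simp
  | add t t' h h' => simp only [map_add, h, h', smul_add, Finset.sum_add_distrib]
  | tmul a p => simp [Finset.sum_smul, smul_smul]

/-- Both composites are double contractions of the same element of A ⊗ D ⊗ D, which is symmetric in
the two copies of D. -/
theorem IsDStar.op_comm {e : A →ₐ[K] A ⊗[K] D} (he : IsDStar e) (l μ : D →ₗ[K] K) (a : A) :
    op e l (op e μ a) = op e μ (op e l a) := by
  let C (l μ : D →ₗ[K] K) : (A ⊗[K] D) ⊗[K] D →ₗ[K] A := contract A l ∘ₗ contract (A ⊗[K] D) μ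
  have hC : ∀ (l μ : D →ₗ[K] K) (t : A ⊗[K] D),
      C l μ (Algebra.TensorProduct.map e (AlgHom.id K D) t) = op e l (contract A μ t) := by
    intro l μ t
    induction t using TensorProduct.induction_on with
    | zero => simp
    | add t t' h h' => simp only [map_add, h, h']
    | tmul a p => simp [C, op_apply]
  have hs : ∀ (l μ : D →ₗ[K] K) t, C l μ (TensorProduct.rightComm K A D D t) = C μ l t := by
    intro l μ t
    induction t using TensorProduct.induction_on with
    | zero => simp
    | add t t' h h' => simp only [map_add, h, h']
    | tmul t q =>
      induction t using TensorProduct.induction_on with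
      | zero => simp
      | add t t' h h' => simp only [map_add, h, h', TensorProduct.add_tmul]
      | tmul a p => simp [C, smul_smul, mul_comm]
  rw [op_apply e μ, op_apply e l a, ← hC, ← hC, ← hs, he]

theorem isDIdeal_iff {n : ℕ} (b : Module.Basis (Fin n) K D) (e : A →ₐ[K] A ⊗[K] D)
    (I : Ideal A) : IsDIdeal e I ↔ ∀ k, ∀ a ∈ I, op e (b.coord k) a ∈ I := by
  refine ⟨fun h k a ha => ?_, fun h a ha => ?_⟩
  · have := h a ha
    rw [op_apply]
    -- All functionals are treated at once, since multiplying by `a ⊗ₜ p` replaces `l` by its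
    -- composite with multiplication by `p`.
    refine Submodule.span_induction (p := fun t _ => ∀ l : D →ₗ[K] K, contract A l t ∈ I)
      ?_ ?_ ?_ ?_ this (b.coord k)
    · rintro _ ⟨a, ha, rfl⟩ l
      simpa using I.smul_of_tower_mem (l 1) ha
    · simp
    · intro x y _ _ hx hy l
      rw [map_add]
      exact I.add_mem (hx l) (hy l)
    · intro s t ht₀ ht l
      rw [smul_eq_mul]
      induction s using TensorProduct.induction_on with
      | zero => simp
      | add s s' h h' => rw [add_mul, map_add]; exact I.add_mem h h'
      | tmul a p =>
        have : contract A l (a ⊗ₜ p * t) = a * contract A (l ∘ₗ LinearMap.mulLeft K p) t := by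
          clear ht ht₀
          induction t using TensorProduct.induction_on with
          | zero => simp
          | add t t' h h' => simp only [mul_add, map_add, h, h']
          | tmul b q => simp [Algebra.TensorProduct.tmul_mul_tmul]
        rw [this]
        exact I.mul_mem_left _ (ht _)
  · rw [← sum_op_coord b e a]
    refine Ideal.sum_mem _ fun k _ => ?_
    have : op e (b.coord k) a ⊗ₜ[K] b k = (1 : A) ⊗ₜ b k *
        (Algebra.TensorProduct.includeLeft : A →ₐ[K] A ⊗[K] D) (op e (b.coord k) a) := by
      simp
    rw [this]
    exact Ideal.mul_mem_left _ _ (Ideal.mem_map_of_mem _ (h k a ha))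

end Operators

end GenOp

end

/-! ### Perfect ideals: colons, finite generation and primality. -/

noncomputable section

namespace GenOp

section Perfect

variable {K D A B : Type*} [Field K] [CommRing D] [Algebra K D] [CommRing A] [Algebra K A]
  [CommRing B] [Algebra K B] {hD : HasBaseResidueFields K D}
  {e : A →ₐ[K] A ⊗[K] D} {f : B →ₐ[K] B ⊗[K] D}

theorem IsPerfect.of_pow_mem {I : Ideal A} (hI : IsPerfect hD e I) {a : A} (n : ℕ)
    (h : a ^ n ∈ I) : a ∈ I :=
  hI.isRadical ⟨n, h⟩

theorem IsPerfect.of_mul_self_mem {I : Ideal A} (hI : IsPerfect hD e I) {a : A}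
    (h : a * a ∈ I) : a ∈ I :=
  hI.of_pow_mem 2 (by rwa [pow_two])

theorem IsPerfect.of_assocEnd_mem {I : Ideal A} (hI : IsPerfect hD e I) {m : MaximalSpectrum D}
    {a : A} (h : assocEnd hD e m a ∈ I) : a ∈ I :=
  hI.isReflexive m a (I.mul_mem_left _ h)

variable (hD e) in
/-- The smallest perfect ideal containing a set. -/
def perfectClosure (T : Set A) : Ideal A := sInf {I | IsPerfect hD e I ∧ T ⊆ I}

theorem subset_perfectClosure (T : Set A) : T ⊆ perfectClosure hD e T := fun _ ha =>
  Submodule.mem_sInf.2 fun _ h => h.2 ha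

theorem IsPerfect.perfectClosure_le {I : Ideal A} (hI : IsPerfect hD e I) {T : Set A}
    (h : T ⊆ I) : perfectClosure hD e T ≤ I :=
  sInf_le ⟨hI, h⟩

variable [FiniteDimensional K D]

theorem IsDIdeal.op_mem {I : Ideal A} (hI : IsDIdeal e I) (l : D →ₗ[K] K) {a : A} (ha : a ∈ I) :
    op e l a ∈ I := by
  let b := Module.finBasis K D
  have hl : ∀ x, l x = ∑ k ∈ Finset.univ, l (b k) * b.coord k x := fun x => by
    conv_lhs => rw [← b.sum_repr x, map_sum]
    exact Finset.sum_congr rfl fun k _ => by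
      rw [map_smul, smul_eq_mul, mul_comm, Module.Basis.coord_apply]
  rw [op_eq_sum e hl]
  exact Ideal.sum_mem _ fun k _ => I.smul_of_tower_mem _ ((isDIdeal_iff b e I).1 hI k a ha)

theorem isDIdeal_iff_forall_op {I : Ideal A} :
    IsDIdeal e I ↔ ∀ l, ∀ a ∈ I, op e l a ∈ I :=
  ⟨fun h l _ ha => h.op_mem l ha, fun h => (isDIdeal_iff (Module.finBasis K D) e I).2 fun _ => h _⟩

theorem IsPerfect.op_mem {I : Ideal A} (hI : IsPerfect hD e I) (l : D →ₗ[K] K) {a : A}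
    (ha : a ∈ I) : op e l a ∈ I :=
  hI.isDIdeal.op_mem l ha

theorem IsPerfect.comap {φ : A →ₐ[K] B} (hφ : IsDHom e f φ) {I : Ideal B}
    (hI : IsPerfect hD f I) : IsPerfect hD e (I.comap φ) where
  isDIdeal := isDIdeal_iff_forall_op.2 fun l a ha => by
    rw [Ideal.mem_comap, ← hφ.op_apply]
    exact hI.op_mem l ha
  isReflexive m a ha := by
    rw [Ideal.mem_comap, map_mul, assocEnd_eq_op, ← hφ.op_apply, ← assocEnd_eq_op] at ha
    exact hI.isReflexive m _ ha
  isRadical := hI.isRadical.comap φ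

theorem IsPerfect.sInf {S : Set (Ideal A)} (hS : ∀ I ∈ S, IsPerfect hD e I) :
    IsPerfect hD e (sInf S) where
  isDIdeal := isDIdeal_iff_forall_op.2 fun l a ha => by
    rw [Submodule.mem_sInf] at ha ⊢
    exact fun I hI => (hS I hI).op_mem l (ha I hI)
  isReflexive m a ha := by
    rw [Submodule.mem_sInf] at ha ⊢
    exact fun I hI => (hS I hI).isReflexive m a (ha I hI)
  isRadical := fun a ⟨n, ha⟩ => by
    rw [Submodule.mem_sInf] at ha ⊢
    exact fun I hI => (hS I hI).of_pow_mem n (ha I hI)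

theorem IsPerfect.sSup {S : Set (Ideal A)} (hne : S.Nonempty) (hdir : DirectedOn (· ≤ ·) S)
    (hS : ∀ I ∈ S, IsPerfect hD e I) : IsPerfect hD e (sSup S) where
  isDIdeal := isDIdeal_iff_forall_op.2 fun l a ha => by
    rw [Submodule.mem_sSup_of_directed hne hdir] at ha ⊢
    obtain ⟨I, hI, ha⟩ := ha
    exact ⟨I, hI, (hS I hI).op_mem l ha⟩
  isReflexive m a ha := by
    rw [Submodule.mem_sSup_of_directed hne hdir] at ha ⊢
    obtain ⟨I, hI, ha⟩ := ha
    exact ⟨I, hI, (hS I hI).isReflexive m a ha⟩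
  isRadical := fun a ⟨n, ha⟩ => by
    rw [Submodule.mem_sSup_of_directed hne hdir] at ha ⊢
    obtain ⟨I, hI, ha⟩ := ha
    exact ⟨I, hI, (hS I hI).of_pow_mem n ha⟩

/-- This is the heart of the colon property. The triangular order lets induction place all
correction terms of the product rule in I, leaving an endomorphism or a twisted derivation. -/
theorem IsPerfect.mul_op_coord_mem {n : ℕ} {b : Module.Basis (Fin n) K D}
    (hb : ∀ k, IsTriangularAt hD b.coord k) {I : Ideal A} (hI : IsPerfect hD e I) (k : Fin n) :
    ∀ x y, x * y ∈ I → y * op e (b.coord k) x ∈ I := by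
  induction k using WellFoundedLT.induction with
  | ind k ih =>
  intro x y hxy
  obtain ⟨m, h | ⟨-, c, hc⟩⟩ := hb k
  · have hk : b.coord k = (residueMap hD m).toLinearMap := LinearMap.ext h
    -- With z = yσ(x), the product zσ(z) is a multiple of σ(x)σ(y) = σ(xy).
    refine hI.isReflexive m _ ?_
    have := hI.op_mem (residueMap hD m).toLinearMap hxy
    rw [hk, assocEnd_eq_op, op_algHom_mul]
    rw [op_algHom_mul] at this
    convert I.mul_mem_left (y * op e (residueMap hD m).toLinearMap
      (op e (residueMap hD m).toLinearMap x)) this using 1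
    have hs := op_algHom_mul e (residueMap hD m)
      y (op e (residueMap hD m).toLinearMap x)
    ring
  · set r := (residueMap hD m).toLinearMap
    have h1 := hI.op_mem (b.coord k) hxy
    rw [op_mul e (r := r) hc] at h1
    have h2 : ∑ i ∈ Finset.Iio k, ∑ j ∈ Finset.Iio k,
        c i j • (op e (b.coord i) x * op e (b.coord j) y) ∈ I := by
      refine Ideal.sum_mem _ fun i hi => Ideal.sum_mem _ fun j hj => I.smul_of_tower_mem _ ?_
      -- The induction hypothesis is used twice: from xy to y·∂ᵢx, then to ∂ᵢx·∂ⱼy.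
      exact ih j (Finset.mem_Iio.1 hj) _ _ (ih i (Finset.mem_Iio.1 hi) _ _ hxy)
    rw [I.add_mem_iff_left h2] at h1
    have h3 : op e r x * op e r y ∈ I := by
      rw [← op_algHom_mul]; exact hI.op_mem r hxy
    -- Multiplying δx·σy + σx·δy by δx·σy and removing a multiple of σx·σy leaves a square.
    have h4 : op e (b.coord k) x * op e r y ∈ I := by
      refine hI.of_mul_self_mem ?_
      convert I.sub_mem (I.mul_mem_left (op e (b.coord k) x * op e r y) h1)
        (I.mul_mem_left (op e (b.coord k) x * op e (b.coord k) y) h3) using 1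
      ring
    refine hI.isReflexive m _ ?_
    rw [assocEnd_eq_op, op_algHom_mul]
    convert I.mul_mem_left (y * op e r (op e (b.coord k) x)) h4 using 1
    ring

theorem IsPerfect.colon {I : Ideal A} (hI : IsPerfect hD e I) (y : A) :
    IsPerfect hD e (Submodule.colon I {y}) where
  isDIdeal := by
    obtain ⟨n, b, hb⟩ := exists_basis_isTriangularAt hD
    refine (isDIdeal_iff b e _).2 fun k x hx => ?_
    rw [Submodule.mem_colon_singleton, smul_eq_mul] at hx ⊢
    rw [mul_comm]
    exact hI.mul_op_coord_mem hb k x y hx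
  isReflexive m a ha := by
    rw [Submodule.mem_colon_singleton, smul_eq_mul] at ha ⊢
    refine hI.isReflexive m _ ?_
    rw [map_mul]
    convert I.mul_mem_left (assocEnd hD e m y) ha using 1
    ring
  isRadical := fun a ⟨n, ha⟩ => by
    rw [Submodule.mem_colon_singleton, smul_eq_mul] at ha ⊢
    refine hI.of_pow_mem (n + 1) ?_
    convert I.mul_mem_left (a * y ^ n) ha using 1
    ring

theorem isPerfect_perfectClosure (T : Set A) : IsPerfect hD e (perfectClosure hD e T) :=
  IsPerfect.sInf fun _ h => h.1

theorem perfectClosure_mono {T U : Set A} (h : T ⊆ U) :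
    perfectClosure hD e T ≤ perfectClosure hD e U :=
  (isPerfect_perfectClosure U).perfectClosure_le (h.trans (subset_perfectClosure U))

variable (hD e) in
/-- Finitely generated as a perfect ideal. -/
def IsPerfectFG (I : Ideal A) : Prop := ∃ T : Finset A, perfectClosure hD e T = I

theorem exists_subset_of_subset_sSup {S : Set (Ideal A)} (hne : S.Nonempty)
    (hdir : DirectedOn (· ≤ ·) S) (T : Finset A) (hT : (T : Set A) ⊆ (sSup S : Ideal A)) :
    ∃ I ∈ S, (T : Set A) ⊆ I := by
  classical
  induction T using Finset.induction_on with
  | empty => exact hne.imp fun I hI => ⟨hI, by simp⟩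
  | insert a T _ ih =>
    rw [Finset.coe_insert, Set.insert_subset_iff] at hT
    obtain ⟨I, hI, hTI⟩ := ih hT.2
    obtain ⟨J, hJ, haJ⟩ := (Submodule.mem_sSup_of_directed hne hdir).1 hT.1
    obtain ⟨L, hL, hIL, hJL⟩ := hdir I hI J hJ
    refine ⟨L, hL, ?_⟩
    rw [Finset.coe_insert, Set.insert_subset_iff]
    exact ⟨hJL haJ, hTI.trans hIL⟩

/-- The closures of a together with finite subsets of P have a directed union, which is perfect;
finitely many generators already lie in one of them. -/
theorem exists_finset_le_perfectClosure_insert {P : Ideal A} {a : A}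
    (h : IsPerfectFG hD e (perfectClosure hD e (insert a P))) :
    ∃ T : Finset A, (T : Set A) ⊆ P ∧ P ≤ perfectClosure hD e (insert a T) := by
  classical
  obtain ⟨T, hT⟩ := h
  let S : Set (Ideal A) :=
    {I | ∃ U : Finset A, (U : Set A) ⊆ P ∧ I = perfectClosure hD e (insert a U)}
  have hne : S.Nonempty := ⟨_, ∅, by simp, rfl⟩
  have hdir : DirectedOn (· ≤ ·) S := by
    rintro _ ⟨U, hU, rfl⟩ _ ⟨V, hV, rfl⟩
    refine ⟨_, ⟨U ∪ V, by simp [hU, hV], rfl⟩, perfectClosure_mono ?_, perfectClosure_mono ?_⟩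
    · exact Set.insert_subset_insert (by simp)
    · exact Set.insert_subset_insert (by simp)
  have hp : IsPerfect hD e (sSup S) := IsPerfect.sSup hne hdir fun I ⟨U, _, hI⟩ =>
    hI ▸ isPerfect_perfectClosure _
  have hle : perfectClosure hD e (insert a P) ≤ sSup S := by
    refine hp.perfectClosure_le (Set.insert_subset ?_ fun x hx => ?_)
    · obtain ⟨I, hI⟩ := hne
      have hI' := hI
      obtain ⟨U, _, rfl⟩ := hI'
      exact (le_sSup hI : _ ≤ sSup S) (subset_perfectClosure _ (Set.mem_insert _ _))
    · have hmem : perfectClosure hD e (insert a (({x} : Finset A) : Set A)) ∈ S :=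
        ⟨{x}, by simpa using hx, rfl⟩
      exact (le_sSup hmem : _ ≤ sSup S) (subset_perfectClosure _ (by simp))
  obtain ⟨_, ⟨U, hU, rfl⟩, hTU⟩ := exists_subset_of_subset_sSup hne hdir T
    (fun x hx => hle (hT.le (subset_perfectClosure _ hx)))
  refine ⟨U, hU, fun x hx => ?_⟩
  have : x ∈ perfectClosure hD e (T : Set A) :=
    hT.ge (subset_perfectClosure _ (Set.mem_insert_of_mem _ hx))
  exact (isPerfect_perfectClosure _).perfectClosure_le hTU this

/-- Among closures of finite subsets of P a maximal one exists, and it absorbs every element of P.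
-/
theorem ACCPerfect.isPerfectFG (h : ACCPerfect hD e) {P : Ideal A} (hP : IsPerfect hD e P) :
    IsPerfectFG hD e P := by
  classical
  have : WellFoundedGT {I : Ideal A // IsPerfect hD e I} :=
    wellFoundedGT_iff_monotone_chain_condition.2 h
  let S : Set {I : Ideal A // IsPerfect hD e I} :=
    {I | ∃ T : Finset A, (T : Set A) ⊆ P ∧ I.1 = perfectClosure hD e T}
  obtain ⟨I, ⟨T, hT, hI⟩, hmax⟩ := this.wf.has_min S
    ⟨⟨_, isPerfect_perfectClosure _⟩, ∅, by simp, rfl⟩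
  refine ⟨T, le_antisymm (hP.perfectClosure_le hT) fun a ha => ?_⟩
  by_contra hna
  refine hmax ⟨perfectClosure hD e ↑(insert a T), isPerfect_perfectClosure _⟩
    ⟨insert a T, by simp [Set.insert_subset_iff, ha, hT], rfl⟩ ?_
  rw [← Subtype.coe_lt_coe, hI]
  refine lt_of_le_of_ne (perfectClosure_mono (by simp)) fun heq => hna ?_
  rw [heq]
  exact subset_perfectClosure _ (by simp)

theorem ACCPerfect.of_isPerfectFG (h : ∀ P, IsPerfect hD e P → IsPerfectFG hD e P) :
    ACCPerfect hD e := by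
  intro I
  let S : Set (Ideal A) := Set.range fun n => (I n).1
  have hne : S.Nonempty := Set.range_nonempty _
  have hdir : DirectedOn (· ≤ ·) S := by
    rintro _ ⟨n, rfl⟩ _ ⟨k, rfl⟩
    exact ⟨_, ⟨max n k, rfl⟩, I.monotone (le_max_left n k), I.monotone (le_max_right n k)⟩
  have hp : IsPerfect hD e (sSup S) := IsPerfect.sSup hne hdir (by rintro _ ⟨n, rfl⟩; exact (I n).2)
  obtain ⟨T, hT⟩ := h _ hp
  obtain ⟨_, ⟨n, rfl⟩, hn⟩ := exists_subset_of_subset_sSup hne hdir T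
    (fun x hx => hT.le (subset_perfectClosure _ hx))
  refine ⟨n, fun k hk => le_antisymm (I.monotone hk) ?_⟩
  have h1 : (I k).1 ≤ sSup S := le_sSup ⟨k, rfl⟩
  exact h1.trans (hT.ge.trans ((I n).2.perfectClosure_le hn))

/-- If some perfect ideal is not finitely generated, then a maximal such ideal exists and is
prime. -/
theorem exists_prime_not_isPerfectFG {P₀ : Ideal A} (h₀ : IsPerfect hD e P₀)
    (hfg : ¬ IsPerfectFG hD e P₀) : ∃ P : Ideal A, IsPerfect hD e P ∧ P.IsPrime ∧
      ¬ IsPerfectFG hD e P ∧ ∀ Q, IsPerfect hD e Q → P < Q → IsPerfectFG hD e Q := by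
  classical
  obtain ⟨P, -, ⟨hP, hPfg⟩, hmax⟩ := zorn_le_nonempty₀
    {I : Ideal A | IsPerfect hD e I ∧ ¬ IsPerfectFG hD e I} (fun c hc hchain I hI => by
      refine ⟨sSup c, ⟨IsPerfect.sSup ⟨I, hI⟩ hchain.directedOn fun J hJ => (hc hJ).1, ?_⟩,
        fun J hJ => le_sSup hJ⟩
      rintro ⟨T, hT⟩
      obtain ⟨J, hJ, hTJ⟩ := exists_subset_of_subset_sSup ⟨I, hI⟩ hchain.directedOn T
        (fun x hx => hT.le (subset_perfectClosure _ hx))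
      refine (hc hJ).2 ⟨T, le_antisymm ((hc hJ).1.perfectClosure_le hTJ) ?_⟩
      rw [hT]
      exact le_sSup hJ) P₀ ⟨h₀, hfg⟩
  have hup : ∀ Q, IsPerfect hD e Q → P < Q → IsPerfectFG hD e Q := fun Q hQ hlt => by
    by_contra hQfg
    exact hlt.not_ge (hmax ⟨hQ, hQfg⟩ hlt.le)
  refine ⟨P, hP, ⟨?_, ?_⟩, hPfg, hup⟩
  · rintro rfl
    refine hPfg ⟨{1}, (Ideal.eq_top_iff_one _).2 (subset_perfectClosure _ (by simp))⟩
  · intro a b hab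
    by_contra! hnot
    have hex : ∀ c, c ∉ P →
        ∃ T : Finset A, (T : Set A) ⊆ P ∧ P ≤ perfectClosure hD e (insert c T) := fun c hc =>
      exists_finset_le_perfectClosure_insert (hup _ (isPerfect_perfectClosure _)
        (lt_of_le_of_ne (fun x hx => subset_perfectClosure _ (Set.mem_insert_of_mem _ hx))
          fun heq => hc (heq.ge (subset_perfectClosure _ (Set.mem_insert _ _)))))
    obtain ⟨T, hTP, hT⟩ := hex a hnot.1
    obtain ⟨U, hUP, hU⟩ := hex b hnot.2
    let V := insert (a * b) (T ∪ U)
    have hV : perfectClosure hD e V ≤ P :=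
      hP.perfectClosure_le (by simp [V, Set.insert_subset_iff, hab, hTP, hUP])
    have hJ := isPerfect_perfectClosure (hD := hD) (e := e) (V : Set A)
    have hVs := subset_perfectClosure (hD := hD) (e := e) (V : Set A)
    refine hPfg ⟨V, le_antisymm hV fun c hc => ?_⟩
    -- The colon J : b contains a and T, hence P, so cb ∈ J. Then J : c contains b and U, hence P
    -- and c itself, so c² ∈ J.
    have h1 : c ∈ Submodule.colon (perfectClosure hD e V) {b} := by
      refine (hJ.colon b).perfectClosure_le (Set.insert_subset ?_ fun t ht => ?_) (hT hc)
      · exact Submodule.mem_colon_singleton.2 (hVs (by simp [V]))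
      · exact Submodule.mem_colon_singleton.2 (Ideal.mul_mem_right _ _ (hVs (by
          simp [V, Finset.mem_coe.1 ht])))
    have h2 : c ∈ Submodule.colon (perfectClosure hD e V) {c} := by
      refine (hJ.colon c).perfectClosure_le (Set.insert_subset ?_ fun t ht => ?_) (hU hc)
      · rw [SetLike.mem_coe, Submodule.mem_colon_singleton, smul_eq_mul, mul_comm]
        exact Submodule.mem_colon_singleton.1 h1
      · exact Submodule.mem_colon_singleton.2 (Ideal.mul_mem_right _ _ (hVs (by
          simp [V, Finset.mem_coe.1 ht])))
    exact hJ.of_mul_self_mem (Submodule.mem_colon_singleton.1 h2)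

theorem ACCPerfect.of_surjective {φ : A →ₐ[K] B} (hφ : IsDHom e f φ)
    (hs : Function.Surjective φ) (h : ACCPerfect hD e) : ACCPerfect hD f := by
  intro I
  obtain ⟨n, hn⟩ := h ⟨fun k => ⟨(I k).1.comap φ, (I k).2.comap hφ⟩, fun i j hij =>
    Ideal.comap_mono (I.monotone hij)⟩
  refine ⟨n, fun k hk => Subtype.ext (Ideal.comap_injective_of_surjective φ hs ?_)⟩
  exact congrArg Subtype.val (hn k hk)

end Perfect

end GenOp

end

/-! ### Polynomial rings on which the operators shift the variables. -/

noncomputable section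

namespace GenOp

open MvPolynomial

section Polynomial

variable {K D R V : Type*} [Field K] [CommRing D] [Algebra K D] [CommRing R] [Algebra K R]
  {n : ℕ}

/-- The `D`-ring structure on a polynomial ring extending that of the coefficients, for which the
coordinate operators shift the variables. -/
def polyD (e : R →ₐ[K] R ⊗[K] D) (b : Module.Basis (Fin n) K D) (sh : Fin n → V → V) :
    MvPolynomial V R →ₐ[K] MvPolynomial V R ⊗[K] D :=
  { eval₂Hom ((Algebra.TensorProduct.map (IsScalarTower.toAlgHom K R (MvPolynomial V R))
      (AlgHom.id K D)).comp e).toRingHom (fun v => ∑ k, X (sh k v) ⊗ₜ[K] b k) with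
    commutes' := fun c => by
      change eval₂Hom _ _ (C (algebraMap K R c)) = _
      rw [eval₂Hom_C]
      exact AlgHom.commutes _ c }

variable (e : R →ₐ[K] R ⊗[K] D) (b : Module.Basis (Fin n) K D) (sh : Fin n → V → V)

theorem polyD_C (r : R) : polyD e b sh (C r) =
    Algebra.TensorProduct.map (IsScalarTower.toAlgHom K R (MvPolynomial V R))
      (AlgHom.id K D) (e r) :=
  eval₂Hom_C _ _ r

theorem polyD_X (v : V) : polyD e b sh (X v) = ∑ k, X (sh k v) ⊗ₜ[K] b k :=
  eval₂Hom_X' _ _ v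

theorem isDHom_polyD :
    IsDHom e (polyD e b sh) (IsScalarTower.toAlgHom K R (MvPolynomial V R)) := fun r =>
  (polyD_C e b sh r).symm

theorem op_polyD_C (l : D →ₗ[K] K) (r : R) : op (polyD e b sh) l (C r) = C (op e l r) :=
  (isDHom_polyD e b sh).op_apply l r

theorem op_polyD_X (k : Fin n) (v : V) : op (polyD e b sh) (b.coord k) (X v) = X (sh k v) := by
  rw [op_apply, polyD_X, map_sum, Finset.sum_eq_single k]
  · simp
  · intro j _ hj
    simp [Finsupp.single_eq_of_ne hj.symm]
  · simp

variable {e b sh}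

theorem X_mem_supported_of_mem {s : Set V} {v : V} (hv : v ∈ s) :
    (X v : MvPolynomial V R) ∈ supported R s := by
  rw [supported_eq_adjoin_X]
  exact Algebra.subset_adjoin ⟨v, hv, rfl⟩

theorem smul_mem_supported {s : Set V} (c : K) {x : MvPolynomial V R}
    (hx : x ∈ supported R s) : c • x ∈ supported R s := by
  rw [← algebraMap_smul R c x]
  exact (supported R s).smul_mem hx _

/-- All indices up to k are handled together because the product rule for one operator involves the
smaller ones. -/
theorem op_polyD_mem_supported {hD : HasBaseResidueFields K D}
    (hb : ∀ k, IsTriangularAt hD b.coord k) {s t : Set V} (k : Fin n)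
    (hst : ∀ v ∈ s, ∀ j ≤ k, sh j v ∈ t) {x : MvPolynomial V R} (hx : x ∈ supported R s) :
    ∀ j ≤ k, op (polyD e b sh) (b.coord j) x ∈ supported R t := by
  rw [supported_eq_adjoin_X] at hx
  induction hx using Algebra.adjoin_induction with
  | mem x hx =>
    obtain ⟨v, hv, rfl⟩ := hx
    intro j hj
    rw [op_polyD_X]
    exact X_mem_supported_of_mem (hst v hv j hj)
  | algebraMap r =>
    intro j _
    change op (polyD e b sh) (b.coord j) (C r) ∈ _
    rw [op_polyD_C]
    exact (supported R t).algebraMap_mem _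
  | add x y _ _ hx hy =>
    intro j hj
    rw [map_add]
    exact add_mem (hx j hj) (hy j hj)
  | mul x y _ _ hx hy =>
    intro j hj
    obtain ⟨m, h | ⟨⟨s, hs⟩, c, hc⟩⟩ := hb j
    · have hk : b.coord j = (residueMap hD m).toLinearMap := LinearMap.ext h
      have hx' := hx j hj
      have hy' := hy j hj
      rw [hk] at hx' hy' ⊢
      rw [op_algHom_mul]
      exact mul_mem hx' hy'
    · have hr : ∀ x : MvPolynomial V R,
          (∀ j ≤ k, op (polyD e b sh) (b.coord j) x ∈ supported R t) →
          op (polyD e b sh) (residueMap hD m).toLinearMap x ∈ supported R t := by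
        intro x hx
        rw [op_eq_sum (polyD e b sh) (r := (residueMap hD m).toLinearMap) hs]
        exact sum_mem fun i hi =>
          smul_mem_supported _ (hx i ((Finset.mem_Iio.1 hi).le.trans hj))
      rw [op_mul (polyD e b sh) (r := (residueMap hD m).toLinearMap) hc]
      refine add_mem (add_mem (mul_mem (hx j hj) (hr y hy)) (mul_mem (hr x hx) (hy j hj)))
        (sum_mem fun i hi => sum_mem fun i' hi' => smul_mem_supported _ (mul_mem ?_ ?_))
      · exact hx i ((Finset.mem_Iio.1 hi).le.trans hj)
      · exact hy i' ((Finset.mem_Iio.1 hi').le.trans hj)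

theorem pderiv_eq_zero_of_mem_supported {s : Set V} {v : V} (hv : v ∉ s) {x : MvPolynomial V R}
    (hx : x ∈ supported R s) : pderiv v x = 0 :=
  pderiv_eq_zero_of_notMem_vars fun h => hv (mem_supported.1 hx h)

/-! ### Leading variables, initials and separants. -/

variable [LinearOrder V]

theorem op_mem_supported_Iio {hD : HasBaseResidueFields K D}
    (hb : ∀ k, IsTriangularAt hD b.coord k) (hmono : ∀ k, StrictMono (sh k))
    (hlt : ∀ i k, i < k → ∀ v, sh i v < sh k v) (k : Fin n) {v : V} {x : MvPolynomial V R}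
    (hx : x ∈ supported R (Set.Iio v)) {j : Fin n} (hj : j ≤ k) :
    op (polyD e b sh) (b.coord j) x ∈ supported R (Set.Iio (sh k v)) := by
  refine op_polyD_mem_supported hb k (fun w hw j hj => ?_) hx j hj
  have h1 : sh k w < sh k v := hmono k hw
  rcases hj.lt_or_eq with hj | rfl
  · exact (hlt j k hj w).trans h1
  · exact h1

theorem op_mem_supported_Iio_of_lt {hD : HasBaseResidueFields K D}
    (hb : ∀ k, IsTriangularAt hD b.coord k) (hmono : ∀ k, StrictMono (sh k))
    (hlt : ∀ i k, i < k → ∀ v, sh i v < sh k v) {j k : Fin n} (hj : j < k) {v : V}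
    {x : MvPolynomial V R} (hx : x ∈ supported R (Set.Iic v)) :
    op (polyD e b sh) (b.coord j) x ∈ supported R (Set.Iio (sh k v)) := by
  refine op_polyD_mem_supported hb j (fun w hw i hi => ?_) hx j le_rfl
  exact (hlt i k (hi.trans_lt hj) w).trans_le ((hmono k).monotone hw)

theorem pderiv_op {hD : HasBaseResidueFields K D} {m : MaximalSpectrum D} {k : Fin n}
    (hk : b.coord k = (residueMap hD m).toLinearMap) (hmono : StrictMono (sh k)) (v : V)
    (x : MvPolynomial V R) : pderiv (sh k v) (op (polyD e b sh) (b.coord k) x) =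
      op (polyD e b sh) (b.coord k) (pderiv v x) := by
  have hmul : ∀ x y, op (polyD e b sh) (b.coord k) (x * y) =
      op (polyD e b sh) (b.coord k) x * op (polyD e b sh) (b.coord k) y := fun x y => by
    rw [hk, op_algHom_mul]
  induction x using MvPolynomial.induction_on with
  | C r => rw [op_polyD_C, pderiv_C, pderiv_C, map_zero]
  | add x y hx hy => simp only [map_add, hx, hy]
  | mul_X x w hx =>
    rw [hmul, op_polyD_X, pderiv_mul, hx, pderiv_mul, map_add, hmul, hmul, op_polyD_X]
    congr 2
    by_cases hw : w = v
    · subst hw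
      rw [pderiv_X_self, pderiv_X_self, ← C_1, op_polyD_C, op_one, hk]
      simp
    · rw [pderiv_X_of_ne hw, pderiv_X_of_ne (hmono.injective.ne hw), map_zero]

/-- A chain rule: in a twisted derivation only the leader v produces the variable `sh k v`, with
coefficient σ(∂x/∂v); the correction terms use smaller operators and hence smaller variables. -/
theorem op_sub_mem_supported {hD : HasBaseResidueFields K D}
    (hb : ∀ k, IsTriangularAt hD b.coord k) (hmono : ∀ k, StrictMono (sh k))
    (hlt : ∀ i k, i < k → ∀ v, sh i v < sh k v) {k : Fin n} {m : MaximalSpectrum D}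
    {s : Fin n → K} (hs : ∀ x, residueMap hD m x = ∑ j ∈ Finset.Iio k, s j * b.coord j x)
    {c : Fin n → Fin n → K} (hc : ∀ x y, b.coord k (x * y) =
        b.coord k x * residueMap hD m y + residueMap hD m x * b.coord k y +
          ∑ i ∈ Finset.Iio k, ∑ j ∈ Finset.Iio k, c i j * (b.coord i x * b.coord j y))
    {v : V} {x : MvPolynomial V R} (hx : x ∈ supported R (Set.Iic v)) :
    op (polyD e b sh) (b.coord k) x - assocEnd hD (polyD e b sh) m (pderiv v x) * X (sh k v) ∈
      supported R (Set.Iio (sh k v)) := by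
  have hr : ∀ {x : MvPolynomial V R}, x ∈ supported R (Set.Iic v) →
      assocEnd hD (polyD e b sh) m x ∈ supported R (Set.Iio (sh k v)) := by
    intro x hx
    rw [assocEnd_eq_op, op_eq_sum (polyD e b sh) (r := (residueMap hD m).toLinearMap) hs]
    exact sum_mem fun i hi => smul_mem_supported _
      (op_mem_supported_Iio_of_lt hb hmono hlt (Finset.mem_Iio.1 hi) hx)
  rw [supported_eq_adjoin_X] at hx
  induction hx using Algebra.adjoin_induction with
  | mem x hx =>
    obtain ⟨w, hw, rfl⟩ := hx
    rw [op_polyD_X]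
    rcases (Set.mem_Iic.1 hw).lt_or_eq with hw | rfl
    · rw [pderiv_X_of_ne hw.ne, map_zero, zero_mul, sub_zero]
      exact X_mem_supported_of_mem (hmono k hw)
    · rw [pderiv_X_self, map_one, one_mul, sub_self]
      exact zero_mem _
  | algebraMap r =>
    change op (polyD e b sh) (b.coord k) (C r) - assocEnd hD _ m (pderiv v (C r)) * _ ∈ _
    rw [op_polyD_C, pderiv_C, map_zero, zero_mul, sub_zero]
    exact (supported R _).algebraMap_mem _
  | add x y _ _ hx hy =>
    convert add_mem hx hy using 1
    simp only [map_add]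
    ring
  | mul x y hxs hys hx hy =>
    rw [← supported_eq_adjoin_X] at hxs hys
    rw [op_mul (polyD e b sh) (r := (residueMap hD m).toLinearMap) hc, ← assocEnd_eq_op,
      ← assocEnd_eq_op, pderiv_mul, map_add, map_mul, map_mul]
    have hsum : ∑ i ∈ Finset.Iio k, ∑ j ∈ Finset.Iio k, c i j •
        (op (polyD e b sh) (b.coord i) x * op (polyD e b sh) (b.coord j) y) ∈
        supported R (Set.Iio (sh k v)) :=
      sum_mem fun i hi => sum_mem fun j hj => smul_mem_supported _ (mul_mem
        (op_mem_supported_Iio_of_lt hb hmono hlt (Finset.mem_Iio.1 hi) hxs)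
        (op_mem_supported_Iio_of_lt hb hmono hlt (Finset.mem_Iio.1 hj) hys))
    convert add_mem (add_mem (mul_mem hx (hr hys)) (mul_mem hy (hr hxs))) hsum using 1
    ring

/-- `F` is a polynomial of degree at most `d` in the variable `v`, whose coefficients involve only
smaller variables. -/
def IsDegLE (v : V) : ℕ → MvPolynomial V R → Prop
  | 0, F => F ∈ supported R (Set.Iio v)
  | d + 1, F => ∃ a ∈ supported R (Set.Iio v), ∃ G, IsDegLE v d G ∧ F = a * X v ^ (d + 1) + G

namespace IsDegLE

variable {v : V} {d : ℕ} {F G : MvPolynomial V R}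

theorem succ (h : IsDegLE v d F) : IsDegLE v (d + 1) F :=
  ⟨0, zero_mem _, F, h, by simp⟩

theorem mono (h : IsDegLE v d F) {d' : ℕ} (hd : d ≤ d') : IsDegLE v d' F := by
  induction hd with
  | refl => exact h
  | step _ ih => exact ih.succ

theorem of_mem (h : F ∈ supported R (Set.Iio v)) : IsDegLE v d F :=
  mono (d := 0) h d.zero_le

theorem add (hF : IsDegLE v d F) (hG : IsDegLE v d G) : IsDegLE v d (F + G) := by
  induction d generalizing F G with
  | zero => exact add_mem hF hG
  | succ d ih =>
    obtain ⟨a, ha, F', hF', rfl⟩ := hF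
    obtain ⟨c, hc, G', hG', rfl⟩ := hG
    exact ⟨a + c, add_mem ha hc, F' + G', ih hF' hG', by ring⟩

theorem mul_left (hF : IsDegLE v d F) {a : MvPolynomial V R} (ha : a ∈ supported R (Set.Iio v)) :
    IsDegLE v d (a * F) := by
  induction d generalizing F with
  | zero => exact mul_mem ha hF
  | succ d ih =>
    obtain ⟨c, hc, F', hF', rfl⟩ := hF
    exact ⟨a * c, mul_mem ha hc, a * F', ih hF', by ring⟩

theorem neg (hF : IsDegLE v d F) : IsDegLE v d (-F) := by
  rw [neg_eq_neg_one_mul]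
  exact hF.mul_left (neg_mem (one_mem _))

theorem sub (hF : IsDegLE v d F) (hG : IsDegLE v d G) : IsDegLE v d (F - G) := by
  rw [sub_eq_add_neg]
  exact hF.add hG.neg

theorem mul_X (hF : IsDegLE v d F) : IsDegLE v (d + 1) (F * X v) := by
  induction d generalizing F with
  | zero => exact ⟨F, hF, 0, zero_mem _, by simp⟩
  | succ d ih =>
    obtain ⟨a, ha, F', hF', rfl⟩ := hF
    exact ⟨a, ha, F' * X v, ih hF', by ring⟩

theorem mul_X_pow (hF : IsDegLE v d F) (j : ℕ) : IsDegLE v (d + j) (F * X v ^ j) := by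
  induction j with
  | zero => simpa using hF
  | succ j ih =>
    rw [pow_succ, ← mul_assoc]
    exact ih.mul_X

theorem mul {d' : ℕ} (hF : IsDegLE v d F) (hG : IsDegLE v d' G) : IsDegLE v (d + d') (F * G) := by
  induction d generalizing F with
  | zero => rw [zero_add]; exact hG.mul_left hF
  | succ d ih =>
    obtain ⟨a, ha, F', hF', rfl⟩ := hF
    have h := (((hG.mul_X_pow (d + 1)).mul_left ha).mono (by omega : d' + (d + 1) ≤ d + 1 + d')).add
      ((ih hF').mono (by omega : d + d' ≤ d + 1 + d'))
    convert h using 1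
    ring

theorem mem_supported (hF : IsDegLE v d F) : F ∈ supported R (Set.Iic v) := by
  induction d generalizing F with
  | zero => exact supported_mono Set.Iio_subset_Iic_self hF
  | succ d ih =>
    obtain ⟨a, ha, F', hF', rfl⟩ := hF
    exact add_mem (mul_mem (supported_mono Set.Iio_subset_Iic_self ha)
      (pow_mem (X_mem_supported_of_mem (Set.mem_Iic.2 le_rfl)) _)) (ih hF')

theorem pderiv_succ (hF : IsDegLE v (d + 1) F) : IsDegLE v d (pderiv v F) := by
  have h0 : ∀ a ∈ supported R (Set.Iio v), pderiv v a = 0 := fun a ha =>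
    pderiv_eq_zero_of_mem_supported (by simp) ha
  induction d generalizing F with
  | zero =>
    obtain ⟨a, ha, F', hF', rfl⟩ := hF
    have : pderiv v (a * X v ^ (0 + 1) + F') = a := by
      simp [h0 a ha, h0 F' hF']
    rw [this]
    exact ha
  | succ d ih =>
    obtain ⟨a, ha, F', hF', rfl⟩ := hF
    refine ⟨a * ((d + 1 + 1 : ℕ) : MvPolynomial V R), mul_mem ha (natCast_mem _ _), _, ih hF', ?_⟩
    simp only [map_add, pderiv_mul, h0 a ha, pderiv_pow, pderiv_X_self]
    simp
    ring

theorem X_mul_pderiv (hF : IsDegLE v d F) : IsDegLE v d (X v * pderiv v F) := by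
  cases d with
  | zero =>
    rw [pderiv_eq_zero_of_mem_supported (by simp) hF, mul_zero]
    exact zero_mem _
  | succ d => rw [mul_comm]; exact hF.pderiv_succ.mul_X

theorem exists_of_mem_supported (hF : F ∈ supported R (Set.Iic v)) : ∃ d, IsDegLE v d F := by
  rw [supported_eq_adjoin_X] at hF
  induction hF using Algebra.adjoin_induction with
  | mem x hx =>
    obtain ⟨w, hw, rfl⟩ := hx
    rcases (Set.mem_Iic.1 hw).lt_or_eq with hw | rfl
    · exact ⟨0, X_mem_supported_of_mem hw⟩
    · exact ⟨1, 1, one_mem _, 0, zero_mem _, by simp⟩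
  | algebraMap r => exact ⟨0, (supported R _).algebraMap_mem r⟩
  | add x y _ _ hx hy =>
    obtain ⟨d, hx⟩ := hx
    obtain ⟨d', hy⟩ := hy
    exact ⟨max d d', (hx.mono (le_max_left _ _)).add (hy.mono (le_max_right _ _))⟩
  | mul x y _ _ hx hy =>
    obtain ⟨d, hx⟩ := hx
    obtain ⟨d', hy⟩ := hy
    exact ⟨d + d', hx.mul hy⟩

end IsDegLE

/-- `G` has degree `d + 1` in its leading variable `v`, and its initial and its separant have the
property `Q`. -/
def IsReducer (Q : MvPolynomial V R → Prop) (v : V) (d : ℕ) (G : MvPolynomial V R) : Prop :=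
  ∃ a ∈ supported R (Set.Iio v), ∃ G', IsDegLE v d G' ∧ G = a * X v ^ (d + 1) + G' ∧ Q a ∧
    Q (pderiv v G)

/-- An endomorphism shifts the leader and transports initial and separant. A twisted derivation
makes G linear in the shifted leader, with σ of the old separant as both initial and separant. -/
theorem IsReducer.op {hD : HasBaseResidueFields K D}
    (hb : ∀ k, IsTriangularAt hD b.coord k) (hmono : ∀ k, StrictMono (sh k))
    (hlt : ∀ i k, i < k → ∀ v, sh i v < sh k v) {Q : MvPolynomial V R → Prop}
    (hQ : ∀ m x, Q x → Q (assocEnd hD (polyD e b sh) m x)) {v : V} {d : ℕ}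
    {G : MvPolynomial V R} (hG : IsReducer Q v d G) (k : Fin n) :
    ∃ d' ≤ d, IsReducer Q (sh k v) d' (op (polyD e b sh) (b.coord k) G) := by
  obtain ⟨a, ha, G', hG', hGe, hQa, hQG⟩ := hG
  have hGs : G ∈ supported R (Set.Iic v) := by
    rw [hGe]
    exact IsDegLE.mem_supported (d := d + 1) ⟨a, ha, G', hG', rfl⟩
  obtain ⟨m, h | ⟨⟨s, hs⟩, c, hc⟩⟩ := hb k
  · have hk : b.coord k = (residueMap hD m).toLinearMap := LinearMap.ext h
    have hσ : ∀ x, GenOp.op (polyD e b sh) (b.coord k) x = assocEnd hD (polyD e b sh) m x :=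
      fun x => by rw [hk, assocEnd_eq_op]
    have hX : ∀ w, assocEnd hD (polyD e b sh) m (X w) = X (sh k w) := fun w => by
      rw [← hσ, op_polyD_X]
    have hs : ∀ x ∈ supported R (Set.Iio v),
        assocEnd hD (polyD e b sh) m x ∈ supported R (Set.Iio (sh k v)) := fun x hx => by
      rw [← hσ]
      exact op_mem_supported_Iio hb hmono hlt k hx le_rfl
    have hdeg : ∀ d F, IsDegLE v d F → IsDegLE (sh k v) d (assocEnd hD (polyD e b sh) m F) := by
      intro d
      induction d with
      | zero => exact hs
      | succ d ih =>
        rintro _ ⟨a, ha, F, hF, rfl⟩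
        exact ⟨_, hs a ha, _, ih F hF, by rw [map_add, map_mul, map_pow, hX]⟩
    refine ⟨d, le_rfl, _, hs a ha, _, hdeg d G' hG', ?_, hQ m a hQa, ?_⟩
    · rw [hσ, hGe, map_add, map_mul, map_pow, hX]
    · rw [pderiv_op hk (hmono k), hσ]
      exact hQ m _ hQG
  · have hmem := op_sub_mem_supported (e := e) hb hmono hlt hs hc hGs
    set σS := assocEnd hD (polyD e b sh) m (pderiv v G) with hσS
    have hSs : pderiv v G ∈ supported R (Set.Iic v) :=
      (IsDegLE.pderiv_succ (d := d) ⟨a, ha, G', hG', hGe⟩).mem_supported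
    have hσSs : σS ∈ supported R (Set.Iio (sh k v)) := by
      rw [hσS, assocEnd_eq_op,
        op_eq_sum (polyD e b sh) (r := (residueMap hD m).toLinearMap) hs]
      exact sum_mem fun i hi => smul_mem_supported _
        (op_mem_supported_Iio_of_lt hb hmono hlt (Finset.mem_Iio.1 hi) hSs)
    have hopG : GenOp.op (polyD e b sh) (b.coord k) G = σS * X (sh k v) ^ (0 + 1) +
        (GenOp.op (polyD e b sh) (b.coord k) G - σS * X (sh k v)) := by ring
    refine ⟨0, d.zero_le, σS, hσSs, _, hmem, hopG, hQ m _ hQG, ?_⟩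
    have h0 : ∀ x ∈ supported R (Set.Iio (sh k v)), pderiv (sh k v) x = 0 := fun x hx =>
      pderiv_eq_zero_of_mem_supported (by simp) hx
    rw [hopG, map_add, h0 _ hmem, zero_add, pow_one, pderiv_mul, h0 _ hσSs, pderiv_X_self]
    simpa using hQ m _ hQG

/-- `w` is obtained from `v` by successive shifts. -/
def Reaches (sh : Fin n → V → V) : V → V → Prop :=
  Relation.ReflTransGen fun v w => ∃ k, w = sh k v

theorem IsReducer.exists_of_reaches [FiniteDimensional K D] {hD : HasBaseResidueFields K D}
    (hb : ∀ k, IsTriangularAt hD b.coord k) (hmono : ∀ k, StrictMono (sh k))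
    (hlt : ∀ i k, i < k → ∀ v, sh i v < sh k v) {Q : MvPolynomial V R → Prop}
    (hQ : ∀ m x, Q x → Q (assocEnd hD (polyD e b sh) m x)) {v w : V} {d : ℕ}
    {G : MvPolynomial V R} (hG : IsReducer Q v d G) {J : Ideal (MvPolynomial V R)}
    (hJ : IsDIdeal (polyD e b sh) J) (hGJ : G ∈ J) (hvw : Reaches sh v w) :
    ∃ d' ≤ d, ∃ G' ∈ J, IsReducer Q w d' G' := by
  induction hvw with
  | refl => exact ⟨d, le_rfl, G, hGJ, hG⟩
  | tail _ h ih =>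
    obtain ⟨k, rfl⟩ := h
    obtain ⟨d', hd', G', hG'J, hG'⟩ := ih
    obtain ⟨d'', hd'', h⟩ := hG'.op hb hmono hlt hQ k
    exact ⟨d'', hd''.trans hd', _, hJ.op_mem _ hG'J, h⟩

/-- Reduction of the elements of `P` modulo the perfect ideal `J`. -/
theorem mul_mem_of_reducers [FiniteDimensional K D] [WellFoundedLT V] [Algebra ℚ R]
    {hD : HasBaseResidueFields K D}
    {f : MvPolynomial V R →ₐ[K] MvPolynomial V R ⊗[K] D} {P J : Ideal (MvPolynomial V R)}
    (hJ : IsPerfect hD f J) {h : MvPolynomial V R} (hC : ∀ r, C r ∈ P → h * C r ∈ J)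
    (hred : ∀ v d F, F ∈ P → IsReducer (· ∉ P) v d F → ∃ d' ≤ d, ∃ G ∈ J, G ∈ P ∧
      IsReducer (fun x => ∀ Q, IsPerfect hD f Q → x ∈ Q → h ∈ Q) v d' G)
    {F : MvPolynomial V R} (hF : F ∈ P) : h * F ∈ J := by
  -- A nonconstant polynomial is viewed as one in its largest variable; constants are covered by
  -- `hC`.
  have reduce : ∀ (p : V → Prop) (F : MvPolynomial V R), F ∈ P →
      (∀ v, p v → ∀ d F, F ∈ P → IsDegLE v d F → h * F ∈ J) →
      (∀ v ∈ F.vars, p v) → h * F ∈ J := by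
    intro p F hF hp hv
    by_cases hne : F.vars.Nonempty
    · have hmem : F ∈ supported R (Set.Iic (F.vars.max' hne)) :=
        mem_supported.2 fun w hw => F.vars.le_max' w hw
      obtain ⟨d, hd⟩ := IsDegLE.exists_of_mem_supported hmem
      exact hp _ (hv _ (F.vars.max'_mem hne)) d F hF hd
    · rw [Finset.not_nonempty_iff_eq_empty, vars_eq_empty_iff_eq_C] at hne
      rw [hne] at hF ⊢
      exact hC _ hF
  have main : ∀ v d F, F ∈ P → IsDegLE v d F → h * F ∈ J := by
    intro v
    induction v using WellFoundedLT.induction with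
    | ind v ihv =>
    intro d
    induction d with
    | zero =>
      intro F hF hd
      exact reduce (· < v) F hF ihv fun w hw => mem_supported.1 hd hw
    | succ d ihd =>
      rintro F hF hdeg
      have hdF := hdeg.pderiv_succ
      obtain ⟨I, hI, F', hF', hFe⟩ := hdeg
      by_cases hIP : I ∈ P
      · have h1 := ihd I hIP (.of_mem hI)
        have h2 : F' ∈ P := by
          rw [hFe] at hF
          exact (P.add_mem_iff_right (P.mul_mem_right _ hIP)).1 hF
        rw [hFe]
        convert J.add_mem (J.mul_mem_right (X v ^ (d + 1)) h1) (ihd F' h2 hF') using 1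
        ring
      by_cases hSP : pderiv v F ∈ P
      -- Characteristic zero enters here: subtracting X·∂F/(d+1) from F cancels the leading term and
      -- stays in P.
      · let q : MvPolynomial V R := C (algebraMap ℚ R ((d + 1 : ℕ) : ℚ)⁻¹)
        have hq : q * ((d + 1 : ℕ) : MvPolynomial V R) = 1 := by
          have : ((d + 1 : ℕ) : MvPolynomial V R) =
              C (algebraMap ℚ R ((d + 1 : ℕ) : ℚ)) := by simp
          rw [this, ← C_mul, ← map_mul, inv_mul_cancel₀ (Nat.cast_ne_zero.2 d.succ_ne_zero),
            map_one, C_1]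
        have hqs : q ∈ supported R (Set.Iio v) := (supported R _).algebraMap_mem _
        have h1 := ihd _ hSP hdF
        have h2 : F - q * (X v * pderiv v F) ∈ P :=
          P.sub_mem hF (P.mul_mem_left _ (P.mul_mem_left _ hSP))
        have h3 : F - q * (X v * pderiv v F) = F' - q * (X v * pderiv v F') := by
          have h0 : pderiv v I = 0 := pderiv_eq_zero_of_mem_supported (by simp) hI
          have hd : pderiv v F = I * (((d + 1 : ℕ) : MvPolynomial V R) * X v ^ d) +
              pderiv v F' := by
            rw [hFe, map_add, pderiv_mul, h0, pderiv_pow, pderiv_X_self]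
            simp
          rw [hd]
          nth_rewrite 1 [hFe]
          linear_combination (- I * X v ^ (d + 1)) * hq
        have h4 := ihd _ h2 (by rw [h3]; exact hF'.sub (hF'.X_mul_pderiv.mul_left hqs))
        convert J.add_mem h4 (J.mul_mem_left (q * X v) h1) using 1
        ring
      · obtain ⟨d', hd', G, hGJ, hGP, a, ha, G', hG', hGe, hQa, -⟩ :=
          hred v d F hF ⟨I, hI, F', hF', hFe, hIP, hSP⟩
        obtain ⟨j, rfl⟩ := Nat.exists_eq_add_of_le hd'
        -- One step of pseudo-division by G cancels the terms of degree d + 1.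
        have h1 : a * F - I * X v ^ j * G = a * F' - I * (G' * X v ^ j) := by
          rw [hFe, hGe]; ring
        have h2 := ihd (a * F - I * X v ^ j * G)
          (P.sub_mem (P.mul_mem_left _ hF) (P.mul_mem_left _ hGP)) (by
            rw [h1]
            exact (hF'.mul_left ha).sub ((hG'.mul_X_pow j).mul_left hI))
        -- This colon is perfect, so containing the initial a it contains h; then h²F ∈ J and (hF)²
        -- ∈ J. Hence a single factor h serves for reductions of any length.
        have h3 : a ∈ Submodule.colon J {h * F} := by
          rw [Submodule.mem_colon_singleton, smul_eq_mul]
          convert J.add_mem h2 (J.mul_mem_left (h * I * X v ^ j) hGJ) using 1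
          ring
        have h4 := hQa _ (hJ.colon (h * F)) h3
        rw [Submodule.mem_colon_singleton, smul_eq_mul] at h4
        refine hJ.of_mul_self_mem ?_
        convert J.mul_mem_left F h4 using 1
        ring
  exact reduce (fun _ => True) F hF (fun v _ => main v) fun _ _ => trivial

end Polynomial

end GenOp

end

/-! ### The basis theorem for 𝒟-polynomial rings. -/

noncomputable section

namespace GenOp

open MvPolynomial

section BasisTheorem

variable {K D R V : Type*} [Field K] [CommRing D] [Algebra K D] [FiniteDimensional K D]
  [CommRing R] [Algebra K R] {n : ℕ}
  {e : R →ₐ[K] R ⊗[K] D} {b : Module.Basis (Fin n) K D} {sh : Fin n → V → V} [LinearOrder V]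

/-- Finitely many reducers suffice to reduce every element with initial and separant outside
a given set. -/
theorem exists_finset_reducers (hwqo : WellQuasiOrdered (Reaches sh))
    (Q : MvPolynomial V R → Prop) (P : Ideal (MvPolynomial V R)) :
    ∃ s : Finset (V × ℕ × MvPolynomial V R),
      (∀ x ∈ s, x.2.2 ∈ P ∧ IsReducer Q x.1 x.2.1 x.2.2) ∧
      ∀ v d F, F ∈ P → IsReducer Q v d F → ∃ x ∈ s, Reaches sh x.1 v ∧ x.2.1 ≤ d := by
  by_contra! hcon
  -- Otherwise one builds a sequence that is bad for the product quasi-order on leaders and degrees.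
  obtain ⟨g, -, hg⟩ := exists_seq_of_forall_finset_exists
    (fun x : V × ℕ × MvPolynomial V R => x.2.2 ∈ P ∧ IsReducer Q x.1 x.2.1 x.2.2)
    (fun x y => Reaches sh x.1 y.1 → y.2.1 < x.2.1) (fun s hs => by
      obtain ⟨v, d, F, hF, hFr, h⟩ := hcon s hs
      exact ⟨(v, d, F), ⟨hF, hFr⟩, h⟩)
  have : IsPreorder V (Reaches sh) :=
    inferInstanceAs (IsPreorder V (Relation.ReflTransGen _))
  obtain ⟨i, j, hij, h1, h2⟩ := (hwqo.prod (wellQuasiOrdered_le (α := ℕ)))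
    fun i => ((g i).1, (g i).2.1)
  exact (hg i j hij h1).not_ge h2

theorem ACCPerfect.polyD [WellFoundedLT V] [Algebra ℚ R] {hD : HasBaseResidueFields K D}
    (hb : ∀ k, IsTriangularAt hD b.coord k) (hmono : ∀ k, StrictMono (sh k))
    (hlt : ∀ i k, i < k → ∀ v, sh i v < sh k v) (hwqo : WellQuasiOrdered (Reaches sh))
    (hacc : ACCPerfect hD e) : ACCPerfect hD (polyD e b sh) := by
  classical
  refine ACCPerfect.of_isPerfectFG fun P₀ hP₀ => ?_
  by_contra hP₀fg
  obtain ⟨P, hP, hPprime, hPfg, hmax⟩ := exists_prime_not_isPerfectFG hP₀ hP₀fg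
  let ι := IsScalarTower.toAlgHom K R (MvPolynomial V R)
  have hι : IsDHom e (GenOp.polyD e b sh) ι := isDHom_polyD e b sh
  obtain ⟨Tp, hTp⟩ := hacc.isPerfectFG (hP.comap hι)
  obtain ⟨s, hs, hsred⟩ := exists_finset_reducers hwqo (· ∉ P) P
  -- Here y is initial times separant, outside P by primality. The new property passes from z to
  -- σ(z), which being outside P need not do.
  have hnot : ∀ x ∈ s, ∃ y ∉ P, ∀ h, y ∣ h → IsReducer
      (fun z => ∀ Q, IsPerfect hD (GenOp.polyD e b sh) Q → z ∈ Q → h ∈ Q) x.1 x.2.1 x.2.2 := by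
    intro x hx
    obtain ⟨a, ha, G', hG', hGe, haP, hSP⟩ := (hs x hx).2
    refine ⟨a * pderiv x.1 x.2.2, fun h => (hPprime.mem_or_mem h).elim haP hSP, fun h hdvd =>
      ⟨a, ha, G', hG', hGe, fun Q _ h' => ?_, fun Q _ h' => ?_⟩⟩
    · exact Q.mem_of_dvd ((dvd_mul_right _ _).trans hdvd) h'
    · exact Q.mem_of_dvd ((dvd_mul_left _ _).trans hdvd) h'
  choose! y hyP hy using hnot
  let h := ∏ x ∈ s, y x
  have hhP : h ∉ P := fun hh => by
    obtain ⟨x, hx, hxP⟩ := hPprime.prod_mem_iff.1 hh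
    exact hyP x hx hxP
  obtain ⟨T₀, hT₀P, hT₀⟩ := exists_finset_le_perfectClosure_insert (hmax _
    (isPerfect_perfectClosure (insert h (P : Set (MvPolynomial V R)))) (lt_of_le_of_ne
      (fun x hx => subset_perfectClosure _ (Set.mem_insert_of_mem _ hx))
      fun heq => hhP (heq.ge (subset_perfectClosure _ (Set.mem_insert _ _)))))
  -- J must contain generators for maximality (`T₀`), for the constants of P (`Tp`) and the reducers
  -- themselves.
  let T := T₀ ∪ Tp.image ι ∪ s.image fun x => x.2.2
  have hTP : (T : Set (MvPolynomial V R)) ⊆ P := by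
    intro t ht
    rcases Finset.mem_union.1 ht with ht | ht
    · rcases Finset.mem_union.1 ht with ht | ht
      · exact hT₀P ht
      · obtain ⟨r, hr, rfl⟩ := Finset.mem_image.1 ht
        exact hTp.le (subset_perfectClosure _ hr)
    · obtain ⟨x, hx, rfl⟩ := Finset.mem_image.1 ht
      exact (hs x hx).1
  have hJ := isPerfect_perfectClosure (hD := hD) (e := GenOp.polyD e b sh)
    (T : Set (MvPolynomial V R))
  have hTJ := subset_perfectClosure (hD := hD) (e := GenOp.polyD e b sh)
    (T : Set (MvPolynomial V R))
  set J := perfectClosure hD (GenOp.polyD e b sh) (T : Set (MvPolynomial V R)) with hJdef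
  have hJP : J ≤ P := hP.perfectClosure_le hTP
  have hC : ∀ r, C r ∈ P → h * C r ∈ J := by
    intro r hr
    refine J.mul_mem_left _ ?_
    have h1 : r ∈ perfectClosure hD e (Tp : Set R) := hTp.ge hr
    refine (hJ.comap hι).perfectClosure_le (fun t ht => ?_) h1
    exact hTJ (Finset.mem_union_left _ (Finset.mem_union_right _ (Finset.mem_image_of_mem _ ht)))
  have hred : ∀ F ∈ P, h * F ∈ J := by
    refine fun F hF => mul_mem_of_reducers hJ hC (fun v d F hF hFr => ?_) hF
    obtain ⟨x, hx, hxv, hxd⟩ := hsred v d F hF hFr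
    obtain ⟨d', hd', G, hGJ, hG⟩ := (hy x hx h (Finset.dvd_prod_of_mem y hx)).exists_of_reaches
      hb hmono hlt (fun m z hz Q hQ hzQ => hz Q hQ (hQ.of_assocEnd_mem hzQ)) hJ.isDIdeal
      (hTJ (Finset.mem_union_right _ (Finset.mem_image_of_mem _ hx))) hxv
    exact ⟨d', hd'.trans hxd, G, hGJ, hJP hGJ, hG⟩
  refine hPfg ⟨T, le_antisymm hJP fun F hF => hJ.of_mul_self_mem ?_⟩
  refine Submodule.mem_colon_singleton.1 ((hJ.colon F).perfectClosure_le
    (Set.insert_subset ?_ fun t ht => ?_) (hT₀ hF))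
  · exact Submodule.mem_colon_singleton.2 (hred F hF)
  · exact Submodule.mem_colon_singleton.2 (J.mul_mem_right _ (hTJ
      (Finset.mem_union_left _ (Finset.mem_union_left _ ht))))

end BasisTheorem

/-! ### Ordering the variables; Dickson's lemma. -/

section Variables

variable {q n : ℕ}

/-- The variables of the `D`-polynomial ring in `q` indeterminates. -/
abbrev DVar (q n : ℕ) : Type := Fin q ×ₗ Colex (Fin n →₀ ℕ)

/-- The variable `θ x_i`. -/
def dvar (i : Fin q) (θ : Fin n →₀ ℕ) : DVar q n := toLex (i, toColex θ)

/-- The action of the `k`-th operator on variables. -/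
def shift (k : Fin n) (v : DVar q n) : DVar q n :=
  dvar (ofLex v).1 (ofColex (ofLex v).2 + Finsupp.single k 1)

theorem shift_strictMono (k : Fin n) : StrictMono (shift (q := q) k) := by
  intro v w h
  rcases Prod.Lex.lt_iff.1 h with h | ⟨h, h'⟩
  · exact Prod.Lex.lt_iff.2 (.inl h)
  · refine Prod.Lex.lt_iff.2 (.inr ⟨h, ?_⟩)
    exact add_lt_add_left (a := toColex (Finsupp.single k 1)) h'

/-- In the colexicographic order the unit multi-indices increase with their index, matching the
triangular order of the operators. -/
theorem shift_lt_shift {i k : Fin n} (h : i < k) (v : DVar q n) : shift i v < shift k v := by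
  refine Prod.Lex.lt_iff.2 (.inr ⟨rfl, ?_⟩)
  exact add_lt_add_right (a := (ofLex v).2) (Finsupp.Colex.single_lt_iff.2 h)

theorem reaches_dvar_add (i : Fin q) (η θ : Fin n →₀ ℕ) :
    Reaches shift (dvar i θ) (dvar i (θ + η)) := by
  induction η using Finsupp.induction_linear generalizing θ with
  | zero => rw [add_zero]; exact .refl
  | add x y hx hy => rw [← add_assoc]; exact (hx θ).trans (hy _)
  | single k m =>
    induction m with
    | zero => rw [Finsupp.single_zero, add_zero]; exact .refl
    | succ m ih =>
      rw [Finsupp.single_add, ← add_assoc]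
      exact ih.tail ⟨k, rfl⟩

theorem wellQuasiOrdered_reaches : WellQuasiOrdered (Reaches (shift (q := q) (n := n))) := by
  intro g
  -- Recording q − i beside the indeterminate's index i turns the inequality of indices into
  -- equality.
  obtain ⟨i, j, hij, h⟩ := wellQuasiOrdered_le (α := ℕ × ℕ × (Fin n →₀ ℕ)) fun i =>
    ((ofLex (g i)).1, q - (ofLex (g i)).1, ofColex (ofLex (g i)).2)
  refine ⟨i, j, hij, ?_⟩
  have h1 : (ofLex (g i)).1 = (ofLex (g j)).1 := by
    have h1 := h.1
    have h2 := h.2.1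
    dsimp only at h1 h2
    ext
    omega
  obtain ⟨η, hη⟩ := exists_add_of_le h.2.2
  have : g j = dvar (ofLex (g i)).1 (ofColex (ofLex (g i)).2 + η) := by
    rw [h1]
    exact congrArg (dvar _) hη
  rw [this]
  exact reaches_dvar_add _ _ _

end Variables

/-! ### S as a quotient of a 𝒟-polynomial ring. -/

section Presentation

variable {K D R S : Type*} [Field K] [CommRing D] [Algebra K D]
  [CommRing R] [Algebra K R] [CommRing S] [Algebra K S] [Algebra R S] [IsScalarTower K R S]
  {e : R →ₐ[K] R ⊗[K] D} {f : S →ₐ[K] S ⊗[K] D} {n : ℕ}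

/-- The evaluation of a polynomial in variables whose values are compatible with the shifts is a
homomorphism of `D`-rings. -/
theorem isDHom_aeval {V : Type*} (b : Module.Basis (Fin n) K D) {sh : Fin n → V → V}
    (hef : IsDAlgebra e f) {val : V → S}
    (hval : ∀ k v, op f (b.coord k) (val v) = val (sh k v)) :
    IsDHom (polyD e b sh) f ((aeval (R := R) val).restrictScalars K) := by
  set φ := (aeval (R := R) val).restrictScalars K
  have hφX : ∀ v, φ (X v) = val v := fun v => aeval_X val v
  intro x
  induction x using MvPolynomial.induction_on with
  | C r =>
    have hφC : φ (C r) = algebraMap R S r := aeval_C val r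
    have hcomp : φ.comp (IsScalarTower.toAlgHom K R (MvPolynomial V R)) =
        IsScalarTower.toAlgHom K R S := AlgHom.ext fun r => aeval_C val r
    rw [polyD_C, hφC, ← hef, ← hcomp, ← AlgHom.comp_apply, ← Algebra.TensorProduct.map_comp,
      AlgHom.comp_id]
  | add x y hx hy => simp only [map_add, hx, hy]
  | mul_X x v hx =>
    rw [map_mul, map_mul, map_mul, map_mul, hx, polyD_X, hφX, ← sum_op_coord b f (val v), map_sum]
    congr 1
    refine Finset.sum_congr rfl fun k _ => ?_
    rw [Algebra.TensorProduct.map_tmul, hφX, hval]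
    rfl

theorem exists_surjective_isDHom (b : Module.Basis (Fin n) K D) (hf : IsDStar f)
    (hef : IsDAlgebra e f) (hfg : FinitelyDGenerated R f) :
    ∃ (q : ℕ) (φ : MvPolynomial (DVar q n) R →ₐ[K] S),
      IsDHom (polyD e b shift) f φ ∧ Function.Surjective φ := by
  obtain ⟨s, hs⟩ := hfg
  -- Commuting operators make the value of a multi-index on a generator independent of the order of
  -- application.
  have : LeftCommutative fun (k : Fin n) (x : S) => op f (b.coord k) x :=
    ⟨fun i j x => hf.op_comm _ _ x⟩
  let val : DVar s.card n → S := fun v =>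
    Multiset.foldr (fun (k : Fin n) (x : S) => op f (b.coord k) x)
      (s.equivFin.symm (ofLex v).1 : S) (Finsupp.toMultiset (ofColex (ofLex v).2))
  have hval : ∀ k v, op f (b.coord k) (val v) = val (shift k v) := by
    intro k v
    have : Finsupp.toMultiset (ofColex (ofLex (shift k v)).2) =
        k ::ₘ Finsupp.toMultiset (ofColex (ofLex v).2) := by
      change Finsupp.toMultiset (ofColex (ofLex v).2 + Finsupp.single k 1) = _
      rw [map_add, Finsupp.toMultiset_single, one_smul, add_comm, Multiset.singleton_add]
    change _ = Multiset.foldr _ _ _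
    rw [this, Multiset.foldr_cons]
    rfl
  have hD := isDHom_aeval b hef hval
  refine ⟨s.card, _, hD, ?_⟩
  -- The image contains the generators and is closed under the operators, so finite 𝒟-generation
  -- forces it to be S.
  have htop : (aeval (R := R) val).range = ⊤ := by
    refine hs _ (fun x hx => ?_) fun x hx => ?_
    · refine ⟨X (dvar (s.equivFin ⟨x, hx⟩) 0), ?_⟩
      change aeval val (X _) = x
      rw [aeval_X]
      simp [val, dvar]
    · obtain ⟨w, rfl⟩ := hx
      rw [← sum_op_coord b f]
      refine sum_mem fun k _ => ?_
      have hmem : op f (b.coord k) (aeval (R := R) val w) ∈ (aeval (R := R) val).range :=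
        ⟨op (polyD e b shift) (b.coord k) w, (hD.op_apply (b.coord k) w).symm⟩
      exact ⟨(⟨_, hmem⟩ : (aeval (R := R) val).range) ⊗ₜ b k,
        Algebra.TensorProduct.map_tmul _ _ _ _⟩
  exact (AlgHom.range_eq_top (aeval (R := R) val)).1 htop

end Presentation

end GenOp

end

theorem mainTheorem2 {K D R S : Type*} [Field K]
    [CommRing D] [Algebra K D] [FiniteDimensional K D]
    (hD : GenOp.HasBaseResidueFields K D)
    [CommRing R] [Algebra K R] [Algebra ℚ R]
    (e : R →ₐ[K] R ⊗[K] D) (he : GenOp.IsDStar e)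
    (hσ : ∀ m : MaximalSpectrum D, Function.Injective (GenOp.assocEnd hD e m))
    [CommRing S] [Algebra K S] [Algebra R S] [IsScalarTower K R S]
    (f : S →ₐ[K] S ⊗[K] D) (hf : GenOp.IsDStar f)
    (hef : GenOp.IsDAlgebra e f) (hfg : GenOp.FinitelyDGenerated R f)
    (hacc : GenOp.ACCPerfect hD e) :
    GenOp.ACCPerfect hD f := by
  obtain ⟨n, b, hb⟩ := GenOp.exists_basis_isTriangularAt hD
  obtain ⟨q, φ, hφ, hsurj⟩ := GenOp.exists_surjective_isDHom b hf hef hfg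
  exact (hacc.polyD hb GenOp.shift_strictMono (fun _ _ h => GenOp.shift_lt_shift h)
    GenOp.wellQuasiOrdered_reaches).of_surjective hφ hsurj
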